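/- Let $\mathbb P^2=\mathbb P^2(\mathbb C)$, let $\check{\mathbb P}^2$ be the dual plane of complex lines, and let $X=\{(z,d)\in\mathbb P^2\times\check{\mathbb P}^2: z\in d\}$ with its projections $p:X\to\mathbb P^2$ and $\pi:X\to\check{\mathbb P}^2$. For a real submanifold $N\subset\mathbb P^2$ of class $\mathcal C^1$ and dimension $\le 3$, let $$p^*N=\{(z,d)\in X:\ z\in N,\ d+T_zN\neq T_z\mathbb P^2\}$$ be the set of pairs formed by a point $z$ of $N$ and a complex line $d$ through $z$ which is not transverse to $N$ at $z$. The dual of $N$ is $\check N=\pi(p^*N)$; for $(z,d)\in p^*N$, the dual germ $(\check N,d)$ of the germ $(N,z)$ is the germ at $d$ of $\pi(p^*N\cap U)$, for small neighbourhoods $U$ of $(z,d)$ in $X$ (when this germ does not depend on $U$). Duals of submanifolds of $\check{\mathbb P}^2$ are defined in the same way, with the roles of $p$ and $\pi$ exchanged. Say that $(N,z)$ is in general position along $d$ if $(z,d)\in p^*N$, $T_zN$ is not a complex line, and $p^*N$ is transverse to $\pi$ at $(z,d)$, i.e. no nonzero tangent vector of $p^*N$ at $(z,d)$ lies in $\ker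 d\pi$. Let $0\le k\le 3$. Consider germs $(N,z)$ of smooth (nonsingular) embedded real submanifolds of dimension $k$ and class $\mathcal C^2$ in $\mathbb P^2$. 1. (General position is generic.) There is an open dense set $G$ of 2-jets of maps of $k$ real variables into $\mathbb C^3$ (homogeneous coordinates) such that, for every germ $(N,z)$ having a parametrization whose 2-jet belongs to $G$, the set of lines $d$ with $(z,d)\in p^*N$ is nonempty, and the lines $d$ along which $(N,z)$ is in general position are dense in it. 2. (Biduality.) If $(N,z)$ is in general position along $d$, then the dual germ $(\check N,d)$ is well defined and is a germ of smooth real submanifold of class $\mathcal C^1$ (of dimension $\le 3$) of $\check{\mathbb P}^2$, and its dual germ at $z$ is well defined and equal to $(N,z)$: $\;N=\check{\check N}$. -/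

import Mathlib

open Set Filter Topology
open scoped LinearAlgebra.Projectivization

/-- Homogeneous coordinates. -/
abbrev HomCoord : Type := Fin 3 → ℂ

/-- The complex projective plane. A point `d = [a : b : c]` also stands for the complex line
`a X + b Y + c Z = 0`, so the dual projective plane is another copy of the same space; a point `z`
lies on the line `d` exactly when `z.orthogonal d`, a relation which is symmetric in `z` and `d`. -/
abbrev ProjPlane : Type := ℙ ℂ HomCoord

/-- The usual topology of the projective plane: the quotient topology. -/
instance ProjPlane.instTopologicalSpace : TopologicalSpace ProjPlane :=
  inferInstanceAs (TopologicalSpace (Quotient (projectivizationSetoid ℂ HomCoord)))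

/-- The cone of nonzero vectors over a subset of the projective plane. -/
def coneOver (N : Set ProjPlane) : Set HomCoord :=
  {v | ∃ hv : v ≠ 0, Projectivization.mk ℂ v hv ∈ N}

/-- The map `φ`, with values in homogeneous coordinates, is near `0` a parametrization of class
`C^r` by `k` real variables of the germ `(N, z)`: the map `t ↦ [φ t]` is of class `C^r`, is an
immersion at `0`, sends `0` to `z`, and near `z` the set `N` is the image of every sufficiently
small neighbourhood of `0` (so that the parametrization is a local embedding). -/
def IsParametrization (r : WithTop ℕ∞) {k : ℕ} (φ : EuclideanSpace ℝ (Fin k) → HomCoord)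
    (N : Set ProjPlane) (z : ProjPlane) : Prop :=
  ContDiffAt ℝ r φ 0 ∧
  (∃ h0 : φ 0 ≠ 0, Projectivization.mk ℂ (φ 0) h0 = z) ∧
  (∀ t, fderiv ℝ φ 0 t ∈ Submodule.span ℂ {φ 0} → t = 0) ∧
  ∃ U₀ ∈ 𝓝 (0 : EuclideanSpace ℝ (Fin k)), ∀ U ∈ 𝓝 (0 : EuclideanSpace ℝ (Fin k)), U ⊆ U₀ →
    ∀ᶠ q in 𝓝 z, (q ∈ N ↔ ∃ t ∈ U, ∃ ht : φ t ≠ 0, Projectivization.mk ℂ (φ t) ht = q)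

/-- `(N, z)` is a germ of smooth (that is, nonsingular) embedded real submanifold of real
dimension `k` and of class `C^r` in the projective plane. -/
def IsSubmanifoldGerm (r : WithTop ℕ∞) (k : ℕ) (N : Set ProjPlane) (z : ProjPlane) : Prop :=
  ∃ φ : EuclideanSpace ℝ (Fin k) → HomCoord, IsParametrization r φ N z

/-- The real tangent space at `v` of the cone over `N`. If `N` is a submanifold near `z = [v]`, this
is the full preimage of `T_z N` under the differential `ℂ³ → T_z ℙ²` at `v` of the projection. -/
noncomputable def coneTangent (N : Set ProjPlane) (v : HomCoord) : Submodule ℝ HomCoord :=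
  Submodule.span ℝ (tangentConeAt ℝ (coneOver N) v)

/-- The complex plane in `ℂ³` over the complex line `d`, as a real vector space. -/
noncomputable def linePlane (d : ProjPlane) : Submodule ℝ HomCoord where
  carrier := {v | v ⬝ᵥ d.rep = 0}
  add_mem' := by
    intro a b ha hb
    simp only [Set.mem_ofPred_eq] at *
    rw [add_dotProduct, ha, hb, add_zero]
  zero_mem' := by simp
  smul_mem' := by
    intro c a ha
    simp only [Set.mem_ofPred_eq] at *
    rw [smul_dotProduct, ha, smul_zero]

/-- The lift `p^* N`, inside the incidence variety `X = {(z, d) | z ∈ d}`: the pairs `(z, d)` where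
`z` is a point of `N` and `d` is a complex line through `z` that is not transverse to `N` at `z`,
i.e. `d + T_z N ≠ T_z ℙ²`. All three spaces are pulled back here to `ℂ³`; the condition does not
depend on the representative of `z`. -/
def liftSet (N : Set ProjPlane) : Set (ProjPlane × ProjPlane) :=
  {w | w.1 ∈ N ∧ w.1.orthogonal w.2 ∧ linePlane w.2 ⊔ coneTangent N w.1.rep ≠ ⊤}

/-- `(D, d)` is the dual germ of the germ `(N, z)` at the line `d`: one has `(z, d) ∈ p^* N`, and
`D` is, near `d`, the image under `π` of every sufficiently small neighbourhood of `(z, d)`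
in `p^* N`, where `π (z, d) = d`. -/
def IsDualGerm (N : Set ProjPlane) (z d : ProjPlane) (D : Set ProjPlane) : Prop :=
  (z, d) ∈ liftSet N ∧
  ∃ U₀ ∈ 𝓝 (z, d), ∀ U ∈ 𝓝 (z, d), U ⊆ U₀ →
    ∀ᶠ e in 𝓝 d, (e ∈ D ↔ e ∈ Prod.snd '' (liftSet N ∩ U))

/-- The bicone in `ℂ³ × ℂ³` over a set of pairs (point, line). -/
def biconeOver (M : Set (ProjPlane × ProjPlane)) : Set (HomCoord × HomCoord) :=
  {q | ∃ (h₁ : q.1 ≠ 0) (h₂ : q.2 ≠ 0),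
    (Projectivization.mk ℂ q.1 h₁, Projectivization.mk ℂ q.2 h₂) ∈ M}

/-- `M` is transverse at `(z, d)` to the projection `π (z, d) = d`: no nonzero tangent vector of
`M` at `(z, d)` is killed by the differential of `π`. In homogeneous coordinates a vector `(v, ℓ)`
projects to zero in the tangent space of the first (resp. second) factor exactly when `v` (resp.
`ℓ`) is a complex multiple of the base vector. -/
def IsTransverseToSnd (M : Set (ProjPlane × ProjPlane)) (z d : ProjPlane) : Prop :=
  ∀ q ∈ Submodule.span ℝ (tangentConeAt ℝ (biconeOver M) (z.rep, d.rep)),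
    q.2 ∈ Submodule.span ℂ {d.rep} → q.1 ∈ Submodule.span ℂ {z.rep}

/-- The germ `(N, z)` is in general position along the line `d`: `d` is a non-transverse line of
`N` at `z`, the tangent space `T_z N` is not a complex line, and `p^* N` is transverse to `π` at
`(z, d)`. -/
def IsGeneralPosition (N : Set ProjPlane) (z d : ProjPlane) : Prop :=
  (z, d) ∈ liftSet N ∧
  (∀ e : ProjPlane, coneTangent N z.rep ≠ linePlane e) ∧
  IsTransverseToSnd (liftSet N) z d

/-- Values, first derivatives and second derivatives, at a point, of maps of `k` real variables. -/
abbrev TwoJet (k : ℕ) : Type :=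
  HomCoord × (EuclideanSpace ℝ (Fin k) →L[ℝ] HomCoord) ×
    (EuclideanSpace ℝ (Fin k) →L[ℝ] EuclideanSpace ℝ (Fin k) →L[ℝ] HomCoord)

/-- The actual 2-jets: the second derivative is symmetric. -/
def symmetricJets (k : ℕ) : Set (TwoJet k) :=
  {j | ∀ s t, j.2.2 s t = j.2.2 t s}

/-- The 2-jet of a map at the origin. -/
noncomputable def twoJet {k : ℕ} (φ : EuclideanSpace ℝ (Fin k) → HomCoord) : TwoJet k :=
  (φ 0, fderiv ℝ φ 0, fderiv ℝ (fderiv ℝ φ) 0)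

/-! Everything is lifted to `ℂ³`. A germ parametrized by `φ` has a cone parametrized by `(c, t) ↦ c
• φ t`, whose tangent space at `φ t` is the range of `coneMap (φ t, fderiv ℝ φ t)`. Every real
linear form on `ℂ³` is `x ↦ Re (l ⬝ x)`, and such a form kills the plane of a line `[l₀]` only if
`l` is a complex multiple of `l₀`. Hence `[l₀]` is non-transverse at `[φ t]` exactly when some
nonzero multiple `l` of `l₀` is conormal: `l ⬝ φ t = 0` and `Re (l ⬝ dφ t) = 0`
(`mem_liftSet_ofVec_iff`). The lift is thus a projectivized conormal bundle.

Biduality. At an immersive jet the conormal space has real dimension `4 - k`. If `k ≥ 1`, general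
position prevents `l` and `i l` from both being conormal (`not_isConormal_I_smul`), so near `(z, d)`
the complex class of a conormal vector determines it up to a real factor. The lift is then a `C^1`
family `ψ` of conormals over `k + (4 - k) - 1 = 3` real parameters, with a linear projection `τ` to
the parameters of `φ` (`exists_conormal_family`). Transversality to `π` makes `[ψ]` an immersion, so
its image `D` is a smooth hypersurface. Differentiating `ψ ⬝ (φ ∘ τ) = 0` shows that conormality is
symmetric: `φ ∘ τ` is conormal to `ψ` (`isConormal_symm`). Conormals of a hypersurface form a real
line, so they are all multiples of `φ ∘ τ`; the lift of `D` is the lift of `N` with its factors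
exchanged, and the dual of `D` is `N` (`exists_dualGerm_of_parametrization`). If `k = 0`, the dual
is the pencil of lines through `z`, of real dimension 2, and the same criterion applies by direct
computation.

Genericity. For `k ≥ 1`, general position along a conormal `l` follows from injectivity of the
linear map obtained by bordering the form `Re (l ⬝ d²φ)` with `Im (l ⬝ dφ)`
(`IsParametrization.isGeneralPosition`). Injectivity is open, and conormals vary continuously with
the jet. On a segment of linear maps ending at an injective one, injectivity fails for finitely many
parameters only (`finite_not_injective_segment`). Applied to jets with `l` fixed, this gives density
of the good jets, once one model jet is exhibited for each `l`; applied to conormals with the jet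
fixed, it gives density of the good lines. -/

/-- The point of the projective plane with given homogeneous coordinates (junk at `0`). -/
noncomputable def ProjPlane.ofVec (v : HomCoord) : ProjPlane :=
  open Classical in
  if h : v ≠ 0 then Projectivization.mk ℂ v h
  else Projectivization.mk ℂ (1 : HomCoord) one_ne_zero

open ProjPlane

/-! ### Homogeneous coordinates and the quotient topology. -/

theorem ofVec_eq_mk {v : HomCoord} (h : v ≠ 0) : ofVec v = Projectivization.mk ℂ v h :=
  dif_pos h

theorem ofVec_rep (d : ProjPlane) : ofVec d.rep = d := by
  rw [ofVec_eq_mk d.rep_nonzero, Projectivization.mk_rep]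

theorem ofVec_eq_ofVec_iff {v w : HomCoord} (hv : v ≠ 0) (hw : w ≠ 0) :
    ofVec v = ofVec w ↔ ∃ c : ℂ, c ≠ 0 ∧ v = c • w := by
  rw [ofVec_eq_mk hv, ofVec_eq_mk hw, Projectivization.mk_eq_mk_iff']
  constructor
  · rintro ⟨c, hc⟩
    refine ⟨c, ?_, hc.symm⟩
    rintro rfl
    exact hv (by rw [← hc, zero_smul])
  · rintro ⟨c, -, hc⟩
    exact ⟨c, hc.symm⟩

theorem ofVec_smul {c : ℂ} (hc : c ≠ 0) {v : HomCoord} (hv : v ≠ 0) : ofVec (c • v) = ofVec v :=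
  (ofVec_eq_ofVec_iff (smul_ne_zero hc hv) hv).2 ⟨c, hc, rfl⟩

theorem exists_smul_rep {v : HomCoord} (hv : v ≠ 0) :
    ∃ c : ℂ, c ≠ 0 ∧ (ofVec v).rep = c • v :=
  (ofVec_eq_ofVec_iff (ofVec v).rep_nonzero hv).1 (ofVec_rep _)

theorem mem_coneOver_iff {N : Set ProjPlane} {v : HomCoord} :
    v ∈ coneOver N ↔ v ≠ 0 ∧ ofVec v ∈ N := by
  constructor
  · rintro ⟨h, hm⟩
    exact ⟨h, by rwa [ofVec_eq_mk h]⟩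
  · rintro ⟨h, hm⟩
    exact ⟨h, by rwa [ofVec_eq_mk h] at hm⟩

theorem mem_biconeOver_iff {M : Set (ProjPlane × ProjPlane)} {q : HomCoord × HomCoord} :
    q ∈ biconeOver M ↔ q.1 ≠ 0 ∧ q.2 ≠ 0 ∧ (ofVec q.1, ofVec q.2) ∈ M := by
  constructor
  · rintro ⟨h, h', hm⟩
    exact ⟨h, h', by rwa [ofVec_eq_mk h, ofVec_eq_mk h']⟩
  · rintro ⟨h, h', hm⟩
    exact ⟨h, h', by rwa [ofVec_eq_mk h, ofVec_eq_mk h'] at hm⟩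

theorem orthogonal_ofVec {v w : HomCoord} (hv : v ≠ 0) (hw : w ≠ 0) :
    (ofVec v).orthogonal (ofVec w) ↔ v ⬝ᵥ w = 0 := by
  rw [ofVec_eq_mk hv, ofVec_eq_mk hw, Projectivization.orthogonal_mk]

theorem mem_linePlane_ofVec {l x : HomCoord} (hl : l ≠ 0) :
    x ∈ linePlane (ofVec l) ↔ x ⬝ᵥ l = 0 := by
  obtain ⟨c, hc, h⟩ := exists_smul_rep hl
  change x ⬝ᵥ (ofVec l).rep = 0 ↔ _
  rw [h, dotProduct_smul, smul_eq_zero]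
  simp [hc]

theorem exists_ne_zero_apply {v : HomCoord} (hv : v ≠ 0) : ∃ i, v i ≠ 0 := by
  by_contra! h
  exact hv (funext h)

/-- The saturation of an open set is the union of its multiples by nonzero scalars, hence open. -/
theorem isOpenQuotientMap_mk :
    IsOpenQuotientMap (fun v : {v : HomCoord // v ≠ 0} ↦ Projectivization.mk ℂ v.1 v.2) := by
  refine ⟨fun d ↦ ⟨⟨d.rep, d.rep_nonzero⟩, d.mk_rep⟩, continuous_quot_mk, ?_⟩
  intro s hs
  change IsOpen ((fun v : {v : HomCoord // v ≠ 0} ↦ Projectivization.mk ℂ v.1 v.2) ⁻¹' _)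
  have : ((fun v : {v : HomCoord // v ≠ 0} ↦ Projectivization.mk ℂ v.1 v.2) ⁻¹'
      ((fun v : {v : HomCoord // v ≠ 0} ↦ Projectivization.mk ℂ v.1 v.2) '' s)) =
      ⋃ c : ℂˣ, (fun v : {v : HomCoord // v ≠ 0} ↦
        (⟨c • v.1, (smul_ne_zero_iff_ne c).2 v.2⟩ : {v : HomCoord // v ≠ 0})) ⁻¹' s := by
    ext v
    simp only [mem_preimage, mem_image, mem_iUnion]
    constructor
    · rintro ⟨w, hw, h⟩
      obtain ⟨c, hc⟩ := (Projectivization.mk_eq_mk_iff ℂ _ _ w.2 v.2).1 h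
      exact ⟨c, by convert hw⟩
    · rintro ⟨c, hc⟩
      exact ⟨_, hc, (Projectivization.mk_eq_mk_iff ℂ _ _ _ _).2 ⟨c, rfl⟩⟩
  rw [this]
  refine isOpen_iUnion fun c ↦ hs.preimage ?_
  exact Continuous.subtype_mk (continuous_subtype_val.const_smul c) _

/-- This turns germ statements in the plane into statements about vectors near a chosen
representative. -/
theorem nhds_ofVec {v : HomCoord} (hv : v ≠ 0) : 𝓝 (ofVec v) = map ofVec (𝓝 v) := by
  have h1 := isOpenQuotientMap_mk.isOpenMap.map_nhds_eq
    isOpenQuotientMap_mk.continuous.continuousAt (x := ⟨v, hv⟩)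
  have h2 : (fun v : {v : HomCoord // v ≠ 0} ↦ Projectivization.mk ℂ v.1 v.2) =
      fun v ↦ ofVec v.1 := by
    funext v
    rw [ofVec_eq_mk v.2]
  rw [h2] at h1
  refine (congrArg 𝓝 (ofVec_eq_mk hv)).trans (h1.symm.trans ?_)
  have h3 : map ((↑) : {v : HomCoord // v ≠ 0} → HomCoord) (𝓝 ⟨v, hv⟩) = 𝓝 v :=
    map_nhds_subtype_coe_eq_nhds (p := fun v : HomCoord ↦ v ≠ 0) hv (isOpen_ne.mem_nhds hv)
  rw [← h3, Filter.map_map]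
  rfl

theorem tendsto_ofVec {v : HomCoord} (hv : v ≠ 0) : Tendsto ofVec (𝓝 v) (𝓝 (ofVec v)) := by
  rw [nhds_ofVec hv]
  exact tendsto_map

/-! ### Real linear forms on `ℂ³` and conormal vectors. -/

/-- The complex bilinear pairing of homogeneous coordinates, as a real bilinear map. -/
noncomputable def dotL : HomCoord →L[ℝ] HomCoord →L[ℝ] ℂ :=
  ∑ i : Fin 3, (ContinuousLinearMap.mul ℝ ℂ).bilinearComp
    (ContinuousLinearMap.proj i) (ContinuousLinearMap.proj i)

@[simp] theorem dotL_apply (x y : HomCoord) : dotL x y = x ⬝ᵥ y := by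
  simp [dotL, dotProduct]

/-- The real linear form `x ↦ Re (l ⬝ x)`. -/
noncomputable def rePair : HomCoord →L[ℝ] HomCoord →L[ℝ] ℝ :=
  (ContinuousLinearMap.compL ℝ HomCoord ℂ ℝ Complex.reCLM) ∘L dotL

@[simp] theorem rePair_apply (x y : HomCoord) : rePair x y = (x ⬝ᵥ y).re := by
  simp [rePair]

theorem rePair_injective : Function.Injective rePair := by
  rw [injective_iff_map_eq_zero]
  intro l hl
  have h : ∀ x, (l ⬝ᵥ x).re = 0 := fun x ↦ by rw [← rePair_apply, hl]; rfl
  funext i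
  have h1 := h (Pi.single i 1)
  have h2 := h (Pi.single i Complex.I)
  simp at h1 h2
  exact Complex.ext h1 h2

theorem finrank_homCoord : Module.finrank ℝ HomCoord = 6 := by
  rw [Module.finrank_pi_fintype]
  simp

theorem rePair_surjective : Function.Surjective rePair := by
  have : Module.finrank ℝ HomCoord = Module.finrank ℝ (HomCoord →L[ℝ] ℝ) := by
    rw [← (LinearMap.toContinuousLinearMap (𝕜 := ℝ) (E := HomCoord) (F' := ℝ)).finrank_eq]
    exact (Subspace.dual_finrank_eq (K := ℝ) (V := HomCoord)).symm
  exact (LinearMap.injective_iff_surjective_of_finrank_eq_finrank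
    (f := (rePair : HomCoord →ₗ[ℝ] _)) this).1 rePair_injective

/-- `v` and `L` being the value and the differential of a map, this is the differential of the
parametrization of the cone over its image. -/
noncomputable def coneMap {E : Type*} [NormedAddCommGroup E] [NormedSpace ℝ E] :
    HomCoord × (E →L[ℝ] HomCoord) →L[ℝ] (ℂ × E →L[ℝ] HomCoord) :=
  ((ContinuousLinearMap.compL ℝ (ℂ × E) ℂ HomCoord).flip (ContinuousLinearMap.fst ℝ ℂ E)) ∘L
    (ContinuousLinearMap.lsmul ℝ ℂ).flip ∘L ContinuousLinearMap.fst ℝ _ _ +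
  ((ContinuousLinearMap.compL ℝ (ℂ × E) E HomCoord).flip (ContinuousLinearMap.snd ℝ ℂ E)) ∘L
    ContinuousLinearMap.snd ℝ _ _

section

variable {E : Type*} [NormedAddCommGroup E] [NormedSpace ℝ E]

@[simp] theorem coneMap_apply (v : HomCoord) (L : E →L[ℝ] HomCoord) (x : ℂ × E) :
    coneMap (v, L) x = x.1 • v + L x.2 := by
  simp [coneMap]

theorem coneMap_injective_iff {v : HomCoord} {L : E →L[ℝ] HomCoord} :
    Function.Injective (coneMap (v, L)) ↔
      v ≠ 0 ∧ ∀ t, L t ∈ Submodule.span ℂ {v} → t = 0 := by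
  rw [injective_iff_map_eq_zero]
  constructor
  · intro h
    refine ⟨?_, fun t ht ↦ ?_⟩
    · rintro rfl
      simpa using h (1, 0) (by simp)
    · obtain ⟨c, hc⟩ := Submodule.mem_span_singleton.1 ht
      have := h (-c, t) (by simp [← hc])
      exact (Prod.ext_iff.1 this).2
  · rintro ⟨hv, h⟩ ⟨c, t⟩ hct
    simp only [coneMap_apply] at hct
    have ht : t = 0 := h t (Submodule.mem_span_singleton.2
      ⟨-c, by rw [neg_smul, eq_comm, ← sub_eq_zero, sub_neg_eq_add, add_comm, hct]⟩)
    subst ht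
    simp [hv] at hct
    simp [hct]

/-- `l` vanishes, in the sense of real parts, on the image of `coneMap j`. -/
def IsConormal (j : HomCoord × (E →L[ℝ] HomCoord)) (l : HomCoord) : Prop :=
  (rePair l) ∘L (coneMap j) = 0

theorem isConormal_iff {v : HomCoord} {L : E →L[ℝ] HomCoord} {l : HomCoord} :
    IsConormal (v, L) l ↔ l ⬝ᵥ v = 0 ∧ ∀ t, (l ⬝ᵥ L t).re = 0 := by
  constructor
  · intro h
    have h1 : ∀ x, (rePair l) (coneMap (v, L) x) = 0 := fun x ↦ by
      rw [← ContinuousLinearMap.comp_apply, h]; rfl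
    refine ⟨Complex.ext ?_ ?_, fun t ↦ ?_⟩
    · simpa using h1 (1, 0)
    · simpa [dotProduct_smul] using h1 (Complex.I, 0)
    · simpa using h1 (0, t)
  · rintro ⟨h1, h2⟩
    ext x <;> simp [h1, h2, dotProduct_smul]

variable {F : Type*} [NormedAddCommGroup F] [NormedSpace ℝ F]

/-- Composing `f` with a linear left inverse of its differential gives a map to which the inverse
function theorem applies. -/
theorem exists_contDiffAt_leftInverse [FiniteDimensional ℝ E] [FiniteDimensional ℝ F] {f : E → F}
    {a : E} (hf : ContDiffAt ℝ 1 f a) (hi : Function.Injective (fderiv ℝ f a)) :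
    ∃ g : F → E, ContDiffAt ℝ 1 g (f a) ∧ ∀ᶠ x in 𝓝 a, g (f x) = x := by
  have : CompleteSpace E := FiniteDimensional.complete ℝ E
  obtain ⟨R, hR⟩ := LinearMap.exists_leftInverse_of_injective (fderiv ℝ f a : E →ₗ[ℝ] F)
    (LinearMap.ker_eq_bot.2 hi)
  let R' : F →L[ℝ] E := LinearMap.toContinuousLinearMap R
  have hR' : R' ∘L fderiv ℝ f a = ContinuousLinearMap.id ℝ E := by
    ext x
    exact LinearMap.congr_fun hR x
  have hc : ContDiffAt ℝ 1 (R' ∘ f) a := R'.contDiff.contDiffAt.comp a hf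
  have hd : HasFDerivAt (R' ∘ f) ((ContinuousLinearEquiv.refl ℝ E : E ≃L[ℝ] E) : E →L[ℝ] E) a := by
    have := R'.hasFDerivAt.comp a (hf.differentiableAt one_ne_zero).hasFDerivAt
    rw [hR'] at this
    exact this
  refine ⟨hc.localInverse hd one_ne_zero ∘ R', ?_, ?_⟩
  · exact ContDiffAt.comp (f a) (hc.to_localInverse hd one_ne_zero) R'.contDiff.contDiffAt
  · exact (hc.hasStrictFDerivAt' hd one_ne_zero).eventually_left_inverse

end

/-! ### Charts of the cone over a parametrized germ. -/

section

variable {E : Type*} [NormedAddCommGroup E] [NormedSpace ℝ E]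

/-- The parametrization of the cone over the image of `ψ`. -/
noncomputable def coneParam (ψ : E → HomCoord) (p : ℂ × E) : HomCoord := p.1 • ψ p.2

theorem hasFDerivAt_coneParam {ψ : E → HomCoord} {x : E} (h : DifferentiableAt ℝ ψ x) :
    HasFDerivAt (coneParam ψ) (coneMap (ψ x, fderiv ℝ ψ x)) (1, x) := by
  have h1 : HasFDerivAt (fun p : ℂ × E ↦ p.1) (ContinuousLinearMap.fst ℝ ℂ E) (1, x) :=
    hasFDerivAt_fst
  have h2 : HasFDerivAt (fun p : ℂ × E ↦ ψ p.2)
      (fderiv ℝ ψ x ∘L ContinuousLinearMap.snd ℝ ℂ E) (1, x) :=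
    HasFDerivAt.comp (g := ψ) (1, x) h.hasFDerivAt hasFDerivAt_snd
  exact (h1.smul h2).congr_fderiv (by ext p <;> simp)

theorem contDiffAt_coneParam {ψ : E → HomCoord} {x : E} {r : WithTop ℕ∞}
    (h : ContDiffAt ℝ r ψ x) (c : ℂ) : ContDiffAt ℝ r (coneParam ψ) (c, x) :=
  contDiffAt_fst.smul (ContDiffAt.comp (c, x) h contDiffAt_snd)

variable [FiniteDimensional ℝ E]

/-- In the last clause the scalar `c` is unrestricted: a nonvanishing coordinate `i` forces `c = y i
/ ψ x i`, which is automatically close to `1` when `y` is close to `ψ 0` and `x` to `0`. -/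
theorem exists_cone_leftInverse {ψ : E → HomCoord} (hψ : ContDiffAt ℝ 1 ψ 0)
    (hi : Function.Injective (coneMap (ψ 0, fderiv ℝ ψ 0))) :
    ∃ G : HomCoord → ℂ × E, ContDiffAt ℝ 1 G (ψ 0) ∧ G (ψ 0) = (1, 0) ∧
      (∀ᶠ p in 𝓝 ((1 : ℂ), (0 : E)), G (coneParam ψ p) = p) ∧
      ∃ V ∈ 𝓝 (0 : E), ∀ᶠ y in 𝓝 (ψ 0), ∀ x ∈ V, ∀ c : ℂ, y = c • ψ x → G y = (c, x) := by
  have h1 : coneParam ψ (1, 0) = ψ 0 := by simp [coneParam]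
  obtain ⟨G, hG, hl⟩ := exists_contDiffAt_leftInverse (contDiffAt_coneParam hψ 1) (by
    rwa [(hasFDerivAt_coneParam (hψ.differentiableAt one_ne_zero)).fderiv])
  rw [h1] at hG
  refine ⟨G, hG, by rw [← hl.self_of_nhds, h1], hl, ?_⟩
  have h0 : ψ 0 ≠ 0 := (coneMap_injective_iff.1 hi).1
  obtain ⟨i, h0i⟩ := exists_ne_zero_apply h0
  have hc : ContinuousAt (fun q : HomCoord × E ↦ ψ q.2 i) (ψ 0, 0) := by
    have : ContinuousAt (fun q : HomCoord × E ↦ ψ q.2) (ψ 0, 0) :=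
      ContinuousAt.comp (f := Prod.snd) (g := ψ) hψ.continuousAt continuousAt_snd
    exact (continuous_apply i).continuousAt.comp this
  have hq : ContinuousAt (fun q : HomCoord × E ↦ (q.1 i / ψ q.2 i, q.2)) (ψ 0, 0) := by
    refine ContinuousAt.prodMk (ContinuousAt.div ?_ hc h0i) continuousAt_snd
    exact (continuous_apply i).continuousAt.comp continuousAt_fst
  have he : ∀ᶠ q in 𝓝 (ψ 0) ×ˢ 𝓝 (0 : E), ψ q.2 i ≠ 0 ∧
      G (coneParam ψ (q.1 i / ψ q.2 i, q.2)) = (q.1 i / ψ q.2 i, q.2) := by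
    rw [← nhds_prod_eq]
    refine (hc.eventually_ne h0i).and (hq.eventually (p := fun p ↦ G (coneParam ψ p) = p) ?_)
    simpa [h0i] using hl
  obtain ⟨p, hp, q, hq, h⟩ := eventually_prod_iff.1 he
  refine ⟨{x | q x}, hq, hp.mono fun y hy x hx c hyc ↦ ?_⟩
  obtain ⟨h2, h3⟩ := h hy hx
  have hc' : y i / ψ x i = c := by
    rw [hyc, Pi.smul_apply, smul_eq_mul, mul_div_cancel_right₀ _ h2]
  simp only [hc'] at h3
  rw [← h3, coneParam, ← hyc]

end

/-! ### Cones and tangent cones of submanifold germs. -/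

section

variable {k : ℕ} {φ : EuclideanSpace ℝ (Fin k) → HomCoord} {N : Set ProjPlane} {z : ProjPlane}
  {r : WithTop ℕ∞}

theorem IsParametrization.coneMap_injective (h : IsParametrization r φ N z) :
    Function.Injective (coneMap (φ 0, fderiv ℝ φ 0)) :=
  coneMap_injective_iff.2 ⟨h.2.1.choose, h.2.2.1⟩

theorem IsParametrization.ne_zero (h : IsParametrization r φ N z) : φ 0 ≠ 0 := h.2.1.choose

theorem IsParametrization.ofVec_eq (h : IsParametrization r φ N z) : ofVec (φ 0) = z := by
  rw [ofVec_eq_mk h.ne_zero]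
  exact h.2.1.choose_spec

theorem IsParametrization.eventually_iff (h : IsParametrization r φ N z) :
    ∃ U₀ ∈ 𝓝 (0 : EuclideanSpace ℝ (Fin k)), ∀ U ∈ 𝓝 (0 : EuclideanSpace ℝ (Fin k)), U ⊆ U₀ →
      ∀ᶠ v in 𝓝 (φ 0), (v ∈ coneOver N ↔ ∃ t ∈ U, φ t ≠ 0 ∧ ofVec (φ t) = ofVec v) := by
  obtain ⟨U₀, hU₀, H⟩ := h.2.2.2
  refine ⟨U₀, hU₀, fun U hU hUU ↦ ?_⟩
  have := H U hU hUU
  rw [← h.ofVec_eq, nhds_ofVec h.ne_zero, eventually_map] at this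
  filter_upwards [this, isOpen_ne.mem_nhds h.ne_zero] with v hv hv0
  rw [mem_coneOver_iff, and_iff_right hv0, hv]
  refine exists_congr fun t ↦ and_congr_right fun _ ↦ ?_
  constructor
  · rintro ⟨h1, h2⟩
    exact ⟨h1, by rw [ofVec_eq_mk h1, h2]⟩
  · rintro ⟨h1, h2⟩
    exact ⟨h1, by rw [← ofVec_eq_mk h1, h2]⟩

theorem IsParametrization.eventually_mem (h : IsParametrization r φ N z) :
    ∀ᶠ t in 𝓝 0, φ t ≠ 0 ∧ φ t ∈ coneOver N := by
  obtain ⟨U₀, hU₀, H⟩ := h.eventually_iff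
  have hc : Tendsto φ (𝓝 0) (𝓝 (φ 0)) := h.1.continuousAt
  filter_upwards [hc.eventually (H U₀ hU₀ subset_rfl), hU₀,
    hc.eventually (isOpen_ne.mem_nhds h.ne_zero)] with t ht htU ht0
  exact ⟨ht0, ht.2 ⟨t, htU, ht0, rfl⟩⟩

theorem IsParametrization.eventually_exists (h : IsParametrization r φ N z)
    {U : Set (EuclideanSpace ℝ (Fin k))} (hU : U ∈ 𝓝 0) :
    ∀ᶠ v in 𝓝 (φ 0), v ∈ coneOver N → ∃ t ∈ U, φ t ≠ 0 ∧ ofVec (φ t) = ofVec v := by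
  obtain ⟨U₀, hU₀, H⟩ := h.eventually_iff
  filter_upwards [H (U ∩ U₀) (inter_mem hU hU₀) inter_subset_right] with v hv hvN
  obtain ⟨t, ht, h⟩ := hv.1 hvN
  exact ⟨t, ht.1, h⟩

/-- The embedding clause of a parametrization says that cone points near `φ 0` are multiples of `φ
t` with `t` small, so the left inverse of `coneParam φ` is also a right inverse on the cone. -/
theorem IsParametrization.exists_chart (h : IsParametrization r φ N z) (hr : 1 ≤ r) :
    ∃ G : HomCoord → ℂ × EuclideanSpace ℝ (Fin k), ContDiffAt ℝ 1 G (φ 0) ∧ G (φ 0) = (1, 0) ∧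
      (∀ᶠ p in 𝓝 ((1 : ℂ), (0 : EuclideanSpace ℝ (Fin k))), G (coneParam φ p) = p) ∧
      ∀ᶠ v in 𝓝 (φ 0), v ∈ coneOver N → coneParam φ (G v) = v := by
  obtain ⟨G, hG, hG0, hl, V, hV, hy⟩ :=
    exists_cone_leftInverse (h.1.of_le hr) h.coneMap_injective
  refine ⟨G, hG, hG0, hl, ?_⟩
  filter_upwards [h.eventually_exists hV, hy] with v hv hy hvN
  obtain ⟨t, ht, ht0, hvt⟩ := hv hvN
  obtain ⟨c, hc, hcv⟩ := (ofVec_eq_ofVec_iff (mem_coneOver_iff.1 hvN).1 ht0).1 hvt.symm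
  rw [hy t ht c hcv, coneParam, hcv]

theorem IsParametrization.eventually_differentiableAt (h : IsParametrization r φ N z)
    (hr : 1 ≤ r) : ∀ᶠ t in 𝓝 0, DifferentiableAt ℝ φ t :=
  ((h.1.of_le hr).eventually (by simp)).mono fun _ h ↦ h.differentiableAt one_ne_zero

/-- On the cone `coneParam φ ∘ G` is the identity, so its differential fixes tangent vectors, which
therefore lie in the range of `coneMap`. Conversely `coneParam φ` maps a full neighbourhood into the
cone. The equality is needed at all nearby parameters, since the dual germ involves nearby points.
-/
theorem IsParametrization.eventually_tangentConeAt (h : IsParametrization r φ N z) (hr : 1 ≤ r) :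
    ∀ᶠ t in 𝓝 0, tangentConeAt ℝ (coneOver N) (φ t) =
      ((coneMap (φ t, fderiv ℝ φ t)).toLinearMap.range : Set HomCoord) := by
  obtain ⟨G, hG, hG0, hl, hright⟩ := h.exists_chart hr
  have hc : Tendsto φ (𝓝 0) (𝓝 (φ 0)) := h.1.continuousAt
  have hGd : ∀ᶠ v in 𝓝 (φ 0), DifferentiableAt ℝ G v :=
    (hG.eventually (by simp)).mono fun _ h ↦ h.differentiableAt one_ne_zero
  have hprod : Tendsto (fun t : EuclideanSpace ℝ (Fin k) ↦ ((1 : ℂ), t)) (𝓝 0) (𝓝 (1, 0)) :=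
    (Continuous.prodMk continuous_const continuous_id).tendsto' _ _ rfl
  have hmem : ∀ᶠ p in 𝓝 ((1 : ℂ), (0 : EuclideanSpace ℝ (Fin k))),
      coneParam φ p ∈ coneOver N := by
    have h1 : ∀ᶠ p in 𝓝 ((1 : ℂ), (0 : EuclideanSpace ℝ (Fin k))),
        φ p.2 ≠ 0 ∧ φ p.2 ∈ coneOver N :=
      (continuous_snd.tendsto ((1 : ℂ), (0 : EuclideanSpace ℝ (Fin k)))).eventually
        h.eventually_mem
    have h2 : ∀ᶠ p in 𝓝 ((1 : ℂ), (0 : EuclideanSpace ℝ (Fin k))), p.1 ≠ 0 :=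
      continuousAt_fst.eventually_ne one_ne_zero
    filter_upwards [h1, h2] with p hp hp1
    rw [mem_coneOver_iff, coneParam, ofVec_smul hp1 hp.1]
    exact ⟨smul_ne_zero hp1 hp.1, (mem_coneOver_iff.1 hp.2).2⟩
  filter_upwards [h.eventually_differentiableAt hr, hc.eventually hGd,
    hc.eventually hright.eventually_nhds, hprod.eventually hmem.eventually_nhds,
    hprod.eventually hl, h.eventually_mem] with t ht hGt hrt hmt hlt hmem_t
  have hF := hasFDerivAt_coneParam ht
  have h1 : coneParam φ (1, t) = φ t := by simp [coneParam]
  rw [h1] at hlt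
  apply Subset.antisymm
  · intro y hy
    have hGF : HasFDerivAt (coneParam φ ∘ G)
        (coneMap (φ t, fderiv ℝ φ t) ∘L fderiv ℝ G (φ t)) (φ t) :=
      HasFDerivAt.comp (φ t) (by rwa [hlt]) hGt.hasFDerivAt
    have h2 : HasFDerivWithinAt (coneParam φ ∘ G) (ContinuousLinearMap.id ℝ HomCoord)
        (coneOver N) (φ t) := by
      refine (hasFDerivWithinAt_id _ _).congr_of_eventuallyEq ?_ ?_
      · exact eventually_nhdsWithin_iff.2 hrt
      · simp [hlt, h1]
    have := hGF.hasFDerivWithinAt.unique_on h2 hy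
    exact ⟨fderiv ℝ G (φ t) y, by simpa using this⟩
  · rintro _ ⟨p, rfl⟩
    have h3 := (hF.hasFDerivWithinAt (s := coneParam φ ⁻¹' coneOver N)).mapsTo_tangent_cone
    rw [h1] at h3
    refine tangentConeAt_mono (image_preimage_subset _ _) (h3 ?_)
    have h4 : coneParam φ ⁻¹' coneOver N ∈ 𝓝 (1, t) := hmt
    rw [tangentConeAt_of_mem_nhds h4]
    trivial

theorem IsParametrization.eventually_coneTangent (h : IsParametrization r φ N z) (hr : 1 ≤ r) :
    ∀ᶠ t in 𝓝 0, coneTangent N (φ t) =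
      (coneMap (φ t, fderiv ℝ φ t)).toLinearMap.range :=
  (h.eventually_tangentConeAt hr).mono fun t ht ↦ by rw [coneTangent, ht, Submodule.span_eq]

end

/-! ### The lift described by conormal vectors. -/

theorem smul_mem_coneOver {N : Set ProjPlane} {c : ℂ} (hc : c ≠ 0) {v : HomCoord} :
    c • v ∈ coneOver N ↔ v ∈ coneOver N := by
  rw [mem_coneOver_iff, mem_coneOver_iff]
  constructor
  · rintro ⟨h1, h2⟩
    have hv : v ≠ 0 := fun h ↦ h1 (by rw [h, smul_zero])
    exact ⟨hv, by rwa [ofVec_smul hc hv] at h2⟩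
  · rintro ⟨hv, h2⟩
    exact ⟨smul_ne_zero hc hv, by rwa [ofVec_smul hc hv]⟩

theorem map_mem_tangentConeAt {E F : Type*} [NormedAddCommGroup E] [NormedSpace ℝ E]
    [NormedAddCommGroup F] [NormedSpace ℝ F] {S : Set E} {T : Set F} (L : E →L[ℝ] F)
    (h : MapsTo L S T) {x y : E} (hy : y ∈ tangentConeAt ℝ S x) :
    L y ∈ tangentConeAt ℝ T (L x) :=
  tangentConeAt_mono h.image_subset (L.hasFDerivWithinAt.mapsTo_tangent_cone hy)

/-- Multiplication by a complex number on homogeneous coordinates, as a real linear map. -/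
noncomputable def smulL (c : ℂ) : HomCoord →L[ℝ] HomCoord :=
  ContinuousLinearMap.lsmul ℝ ℂ c

@[simp] theorem smulL_apply (c : ℂ) (x : HomCoord) : smulL c x = c • x := rfl

theorem smul_mem_coneTangent {N : Set ProjPlane} {c : ℂ} (hc : c ≠ 0) {v x : HomCoord}
    (hx : x ∈ coneTangent N v) : c • x ∈ coneTangent N (c • v) := by
  have h : (coneTangent N v).map (smulL c).toLinearMap ≤ coneTangent N (c • v) := by
    rw [coneTangent, Submodule.map_span_le]
    intro y hy
    exact Submodule.subset_span
      (map_mem_tangentConeAt (smulL c) (fun w hw ↦ (smul_mem_coneOver hc).2 hw) hy)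
  exact h ⟨x, hx, rfl⟩

theorem smul_mem_coneTangent_iff {N : Set ProjPlane} {c : ℂ} (hc : c ≠ 0) {v x : HomCoord} :
    c • x ∈ coneTangent N (c • v) ↔ x ∈ coneTangent N v := by
  refine ⟨fun h ↦ ?_, smul_mem_coneTangent hc⟩
  simpa [smul_smul, hc] using smul_mem_coneTangent (inv_ne_zero hc) h

theorem exists_conormal_of_ne_top {W : Submodule ℝ HomCoord} (hW : W ≠ ⊤) :
    ∃ l ≠ 0, ∀ x ∈ W, rePair l x = 0 := by
  obtain ⟨f, hf, hle⟩ := Submodule.exists_le_ker_of_lt_top W (lt_top_iff_ne_top.2 hW)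
  obtain ⟨l, hl⟩ := rePair_surjective (LinearMap.toContinuousLinearMap f)
  refine ⟨l, ?_, fun x hx ↦ ?_⟩
  · rintro rfl
    rw [map_zero] at hl
    exact hf (LinearMap.toContinuousLinearMap.injective (by rw [← hl, map_zero]))
  · rw [hl]
    exact hle hx

/-- Testing on `x` and `i x` upgrades the real equation to `l' ⬝ x = 0` on the complex plane of `l`;
the vectors `l i • e j - l j • e i` of that plane then give proportionality. -/
theorem exists_eq_smul_of_rePair_eq_zero {l l' : HomCoord} (hl : l ≠ 0)
    (h : ∀ x : HomCoord, x ⬝ᵥ l = 0 → rePair l' x = 0) : ∃ c : ℂ, l' = c • l := by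
  have h0 : ∀ x : HomCoord, x ⬝ᵥ l = 0 → l' ⬝ᵥ x = 0 := fun x hx ↦ by
    have h1 := h x hx
    have h2 := h (Complex.I • x) (by rw [smul_dotProduct, hx, smul_zero])
    simp only [rePair_apply, dotProduct_smul, smul_eq_mul, Complex.mul_re, Complex.I_re,
      Complex.I_im, zero_mul, one_mul, zero_sub, neg_eq_zero] at h1 h2
    exact Complex.ext h1 h2
  obtain ⟨i, hi⟩ := exists_ne_zero_apply hl
  refine ⟨l' i / l i, funext fun j ↦ ?_⟩
  have := h0 (l i • Pi.single j 1 - l j • Pi.single i 1) (by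
    rw [sub_dotProduct, smul_dotProduct, smul_dotProduct, single_one_dotProduct,
      single_one_dotProduct, smul_eq_mul, smul_eq_mul, mul_comm, sub_self])
  rw [dotProduct_sub, dotProduct_smul, dotProduct_smul, dotProduct_single_one,
    dotProduct_single_one, smul_eq_mul, smul_eq_mul] at this
  rw [Pi.smul_apply, smul_eq_mul]
  field_simp
  linear_combination this

section

variable {k : ℕ} {φ : EuclideanSpace ℝ (Fin k) → HomCoord} {N : Set ProjPlane} {z : ProjPlane}
  {r : WithTop ℕ∞}

theorem sup_coneTangent_rep_eq_top_iff {v l : HomCoord} (hv : v ≠ 0) (hl : l ≠ 0) :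
    linePlane (ofVec l) ⊔ coneTangent N (ofVec v).rep = ⊤ ↔
      linePlane (ofVec l) ⊔ coneTangent N v = ⊤ := by
  obtain ⟨c, hc, h⟩ := exists_smul_rep hv
  rw [h, Submodule.eq_top_iff', Submodule.eq_top_iff']
  simp only [Submodule.mem_sup]
  constructor
  · intro H x
    obtain ⟨y, hy, w, hw, hyw⟩ := H (c • x)
    refine ⟨c⁻¹ • y, ?_, c⁻¹ • w, ?_, ?_⟩
    · rw [mem_linePlane_ofVec hl] at hy ⊢
      rw [smul_dotProduct, hy, smul_zero]
    · rw [← smul_mem_coneTangent_iff hc, smul_smul, mul_inv_cancel₀ hc, one_smul]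
      exact hw
    · rw [← smul_add, hyw, smul_smul, inv_mul_cancel₀ hc, one_smul]
  · intro H x
    obtain ⟨y, hy, w, hw, hyw⟩ := H (c⁻¹ • x)
    refine ⟨c • y, ?_, c • w, (smul_mem_coneTangent_iff hc).2 hw, ?_⟩
    · rw [mem_linePlane_ofVec hl] at hy ⊢
      rw [smul_dotProduct, hy, smul_zero]
    · rw [← smul_add, hyw, smul_smul, mul_inv_cancel₀ hc, one_smul]

/-- A sum of real subspaces is proper exactly when a nonzero real form kills both. Vanishing on the
plane of `l` makes that form `Re (c l ⬝ x)`; vanishing on the tangent space is conormality of `c l`.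
-/
theorem mem_liftSet_ofVec_iff {E : Type*} [NormedAddCommGroup E] [NormedSpace ℝ E]
    {v l : HomCoord} {L : E →L[ℝ] HomCoord}
    (hv : v ≠ 0) (hl : l ≠ 0) (hN : v ∈ coneOver N)
    (hT : coneTangent N v = (coneMap (v, L)).toLinearMap.range) :
    (ofVec v, ofVec l) ∈ liftSet N ↔ ∃ c : ℂ, c ≠ 0 ∧ IsConormal (v, L) (c • l) := by
  change (ofVec v ∈ N ∧ _ ∧ _ ≠ _) ↔ _
  rw [and_iff_right (mem_coneOver_iff.1 hN).2, orthogonal_ofVec hv hl, Ne,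
    sup_coneTangent_rep_eq_top_iff hv hl, hT]
  constructor
  · rintro ⟨-, hne⟩
    obtain ⟨l', hl', hle⟩ := exists_conormal_of_ne_top hne
    obtain ⟨c, rfl⟩ := exists_eq_smul_of_rePair_eq_zero hl (l' := l') fun x hx ↦
      hle x (Submodule.mem_sup_left ((mem_linePlane_ofVec hl).2 hx))
    refine ⟨c, fun hc ↦ hl' (by rw [hc, zero_smul]), ?_⟩
    exact ContinuousLinearMap.ext fun x ↦ hle _ (Submodule.mem_sup_right ⟨x, rfl⟩)
  · rintro ⟨c, hc, h⟩
    have h0 : v ⬝ᵥ l = 0 := by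
      have := (isConormal_iff.1 h).1
      rw [smul_dotProduct, smul_eq_zero, dotProduct_comm] at this
      exact this.resolve_left hc
    refine ⟨h0, fun htop ↦ ?_⟩
    have hle : linePlane (ofVec l) ⊔ (coneMap (v, L)).toLinearMap.range ≤
        (rePair (c • l)).toLinearMap.ker := by
      refine sup_le (fun x hx ↦ ?_) ?_
      · rw [mem_linePlane_ofVec hl] at hx
        rw [LinearMap.mem_ker]
        change rePair (c • l) x = 0
        rw [rePair_apply, smul_dotProduct, dotProduct_comm, hx, smul_zero, Complex.zero_re]
      · rintro _ ⟨x, rfl⟩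
        exact DFunLike.congr_fun h x
    rw [htop, top_le_iff, LinearMap.ker_eq_top] at hle
    have : rePair (c • l) = 0 := by
      ext1 x
      exact LinearMap.congr_fun hle x
    exact smul_ne_zero hc hl (rePair_injective (by rw [this, map_zero]))

theorem IsParametrization.eventually_mem_liftSet_iff (h : IsParametrization r φ N z)
    (hr : 1 ≤ r) : ∀ᶠ t in 𝓝 0, ∀ l ≠ 0, ((ofVec (φ t), ofVec l) ∈ liftSet N ↔
      ∃ c : ℂ, c ≠ 0 ∧ IsConormal (φ t, fderiv ℝ φ t) (c • l)) := by
  filter_upwards [h.eventually_mem, h.eventually_coneTangent hr] with t ht hT l hl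
  exact mem_liftSet_ofVec_iff ht.1 hl ht.2 hT

end

theorem nhds_ofVec_prod {v w : HomCoord} (hv : v ≠ 0) (hw : w ≠ 0) :
    𝓝 (ofVec v, ofVec w) = map (Prod.map ofVec ofVec) (𝓝 (v, w)) := by
  rw [nhds_prod_eq, nhds_prod_eq, nhds_ofVec hv, nhds_ofVec hw, prod_map_map_eq]
  rfl

theorem IsParametrization.eventually_exists_eq {k : ℕ} {φ : EuclideanSpace ℝ (Fin k) → HomCoord}
    {N : Set ProjPlane} {z : ProjPlane} {r : WithTop ℕ∞} (h : IsParametrization r φ N z)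
    {U : Set (EuclideanSpace ℝ (Fin k))} (hU : U ∈ 𝓝 0) :
    ∀ᶠ q in 𝓝 z, q ∈ N → ∃ t ∈ U, φ t ≠ 0 ∧ ofVec (φ t) = q := by
  rw [← h.ofVec_eq, nhds_ofVec h.ne_zero, eventually_map]
  filter_upwards [h.eventually_exists hU, isOpen_ne.mem_nhds h.ne_zero] with v hv hv0 hvN
  exact hv (mem_coneOver_iff.2 ⟨hv0, hvN⟩)

/-! ### Dual germs from a parametrized family of conormals. -/

section

variable {m : ℕ} {ψ : EuclideanSpace ℝ (Fin m) → HomCoord}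

/-- The local inverse `G` recovers the parameter continuously from the point, so image points near
`ψ 0` come only from small parameters: the immersion is a local embedding. -/
theorem exists_isParametrization_image (hψ : ContDiffAt ℝ 1 ψ 0)
    (hi : Function.Injective (coneMap (ψ 0, fderiv ℝ ψ 0)))
    {V' : Set (EuclideanSpace ℝ (Fin m))} (hV' : V' ∈ 𝓝 0) :
    ∃ V ∈ 𝓝 (0 : EuclideanSpace ℝ (Fin m)), V ⊆ V' ∧
      IsParametrization 1 ψ {e | ∃ x ∈ V, ψ x ≠ 0 ∧ ofVec (ψ x) = e} (ofVec (ψ 0)) := by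
  obtain ⟨h0, hs⟩ := coneMap_injective_iff.1 hi
  obtain ⟨G, hG, hG0, -, V, hV, hy⟩ := exists_cone_leftInverse hψ hi
  refine ⟨V ∩ V', inter_mem hV hV', inter_subset_right, hψ, ⟨h0, (ofVec_eq_mk h0).symm⟩, hs,
    V ∩ V', inter_mem hV hV', fun U hU hUV ↦ ?_⟩
  have hG2 : Tendsto (fun y ↦ (G y).2) (𝓝 (ψ 0)) (𝓝 0) := by
    have := (continuous_snd.tendsto (G (ψ 0))).comp hG.continuousAt
    rwa [hG0] at this
  rw [nhds_ofVec h0, eventually_map]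
  filter_upwards [hy, hG2.eventually hU, isOpen_ne.mem_nhds h0] with y hy hGU hy0
  constructor
  · rintro ⟨x, hx, hx0, hxy⟩
    obtain ⟨c, hc, hcx⟩ := (ofVec_eq_ofVec_iff hy0 hx0).1 hxy.symm
    have := hy x hx.1 c hcx
    rw [this] at hGU
    exact ⟨x, hGU, hx0, by rw [← ofVec_eq_mk hx0, hxy]⟩
  · rintro ⟨x, hx, hx0, hxy⟩
    exact ⟨x, hUV hx, hx0, by rw [ofVec_eq_mk hx0, hxy]⟩

end

section

variable {E E' : Type*} [NormedAddCommGroup E] [NormedSpace ℝ E]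
  [NormedAddCommGroup E'] [NormedSpace ℝ E']

/-- Differentiate `ψ ⬝ (φ ∘ τ) = 0` and take real parts: the term with `dφ` vanishes by conormality
of `ψ`, which leaves `Re (dψ ⬝ φ ∘ τ) = 0`. -/
theorem isConormal_symm {φ : E → HomCoord} {ψ : E' → HomCoord} {τ : E' →L[ℝ] E} {x : E'}
    (hφ : DifferentiableAt ℝ φ (τ x)) (hψ : DifferentiableAt ℝ ψ x)
    (h : IsConormal (φ (τ x), fderiv ℝ φ (τ x)) (ψ x))
    (h0 : ∀ᶠ y in 𝓝 x, ψ y ⬝ᵥ φ (τ y) = 0) :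
    IsConormal (ψ x, fderiv ℝ ψ x) (φ (τ x)) := by
  rw [isConormal_iff] at h ⊢
  refine ⟨by rw [dotProduct_comm, h.1], fun ξ ↦ ?_⟩
  have h1 : HasFDerivAt (fun y ↦ φ (τ y)) (fderiv ℝ φ (τ x) ∘L τ) x :=
    HasFDerivAt.comp x hφ.hasFDerivAt τ.hasFDerivAt
  have h2 := dotL.hasFDerivAt_of_bilinear hψ.hasFDerivAt h1
  have h3 : HasFDerivAt (fun y ↦ dotL (ψ y) (φ (τ y))) (0 : E' →L[ℝ] ℂ) x := by
    refine (hasFDerivAt_const (0 : ℂ) x).congr_of_eventuallyEq ?_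
    filter_upwards [h0] with y hy
    simp [hy]
  have h4 := congrArg Complex.re (DFunLike.congr_fun (h2.unique h3) ξ)
  simp [h.2] at h4
  rw [dotProduct_comm, h4]

end

/-- By `hcon` and `hcover`, the second projection of the lift of `N` near the base pair is the image
of `ψ`. By `huniq` and the symmetry of conormality, the lift of that image is `{([ψ x], [φ (τ
x)])}`. The section `σ` ensures that all of `N` is recovered. -/
theorem exists_dualGerm_of_parametrization {k m : ℕ} {φ : EuclideanSpace ℝ (Fin k) → HomCoord}
    {N : Set ProjPlane} {z : ProjPlane} {r : WithTop ℕ∞} (hφ : IsParametrization r φ N z)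
    (hr : 1 ≤ r) {ψ : EuclideanSpace ℝ (Fin m) → HomCoord}
    {τ : EuclideanSpace ℝ (Fin m) →L[ℝ] EuclideanSpace ℝ (Fin k)}
    {σ : EuclideanSpace ℝ (Fin k) →L[ℝ] EuclideanSpace ℝ (Fin m)} (hτσ : ∀ t, τ (σ t) = t)
    (hψ : ContDiffAt ℝ 1 ψ 0) (hi : Function.Injective (coneMap (ψ 0, fderiv ℝ ψ 0)))
    (hcon : ∀ᶠ x in 𝓝 0, IsConormal (φ (τ x), fderiv ℝ φ (τ x)) (ψ x))
    (hcover : ∀ V ∈ 𝓝 (0 : EuclideanSpace ℝ (Fin m)), ∀ᶠ q in 𝓝 (φ 0, ψ 0),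
      (ofVec q.1, ofVec q.2) ∈ liftSet N → ∃ x ∈ V, ψ x ≠ 0 ∧ ofVec (ψ x) = ofVec q.2)
    (huniq : ∀ᶠ x in 𝓝 0, ∀ v, IsConormal (ψ x, fderiv ℝ ψ x) v → ∃ c : ℂ, v = c • φ (τ x)) :
    ∃ D : Set ProjPlane, IsDualGerm N z (ofVec (ψ 0)) D ∧
      IsSubmanifoldGerm 1 m D (ofVec (ψ 0)) ∧ IsDualGerm D (ofVec (ψ 0)) z N := by
  obtain ⟨V, hV, -, hD⟩ := exists_isParametrization_image hψ hi univ_mem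
  set D : Set ProjPlane := {e | ∃ x ∈ V, ψ x ≠ 0 ∧ ofVec (ψ x) = e} with hDdef
  have hτ : Tendsto τ (𝓝 0) (𝓝 0) := τ.continuous.tendsto' _ _ (map_zero τ)
  have hσ : Tendsto σ (𝓝 0) (𝓝 0) := σ.continuous.tendsto' _ _ (map_zero σ)
  have hφτ : Tendsto (fun x ↦ φ (τ x)) (𝓝 0) (𝓝 (φ 0)) :=
    Tendsto.comp (g := φ) hφ.1.continuousAt hτ
  have hψc : Tendsto ψ (𝓝 0) (𝓝 (ψ 0)) := hψ.continuousAt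
  have hA : ∀ᶠ x in 𝓝 0, (ofVec (φ (τ x)), ofVec (ψ x)) ∈ liftSet N := by
    filter_upwards [hτ.eventually (hφ.eventually_mem_liftSet_iff hr), hcon,
      hD.eventually_mem] with x hx hc h0
    exact (hx _ h0.1).2 ⟨1, one_ne_zero, by rwa [one_smul]⟩
  have hcon' : ∀ᶠ x in 𝓝 0, IsConormal (ψ x, fderiv ℝ ψ x) (φ (τ x)) := by
    filter_upwards [hτ.eventually (hφ.eventually_differentiableAt hr),
      hD.eventually_differentiableAt le_rfl, hcon.eventually_nhds] with x h1 h2 h3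
    exact isConormal_symm h1 h2 h3.self_of_nhds (h3.mono fun y hy ↦ (isConormal_iff.1 hy).1)
  have hB : ∀ᶠ x in 𝓝 0, ∀ v ≠ 0,
      ((ofVec (ψ x), ofVec v) ∈ liftSet D ↔ ofVec v = ofVec (φ (τ x))) := by
    filter_upwards [hD.eventually_mem_liftSet_iff le_rfl, hcon', huniq,
      hτ.eventually hφ.eventually_mem] with x hx h1 h2 h3 v hv
    rw [hx v hv]
    constructor
    · rintro ⟨c, hc, hcv⟩
      obtain ⟨c', hc'⟩ := h2 _ hcv
      have hc0 : c' ≠ 0 := by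
        rintro rfl
        rw [zero_smul] at hc'
        exact smul_ne_zero hc hv hc'
      rw [← ofVec_smul hc hv, hc', ofVec_smul hc0 h3.1]
    · intro h
      obtain ⟨c, hc, hcv⟩ := (ofVec_eq_ofVec_iff h3.1 hv).1 h.symm
      exact ⟨c, hc, by rwa [← hcv]⟩
  have hz := hφ.ofVec_eq
  have hτ0 : τ 0 = 0 := map_zero τ
  -- The reference neighbourhoods are defined so that one inclusion is tautological; the content is
  -- that they are neighbourhoods, by `hcover` for the first and by `hB` for the second.
  refine ⟨D, ⟨?_, {w | w ∈ liftSet N → w.2 ∈ D}, ?_, fun U hU hUU ↦ ?_⟩, ⟨ψ, hD⟩,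
    ⟨?_, {w | w ∈ liftSet D → w.2 ∈ N}, ?_, fun U hU hUU ↦ ?_⟩⟩
  · have := hA.self_of_nhds
    rwa [hτ0, hz] at this
  · rw [← hz, nhds_ofVec_prod hφ.ne_zero hD.ne_zero]
    exact hcover V hV
  · have hU' : ∀ᶠ x in 𝓝 0, (ofVec (φ (τ x)), ofVec (ψ x)) ∈ U := by
      rw [← hz] at hU
      exact (((tendsto_ofVec hφ.ne_zero).comp hφτ).prodMk_nhds
        ((tendsto_ofVec hD.ne_zero).comp hψc)).eventually hU
    filter_upwards [hD.eventually_exists_eq (hU'.and hA)] with e he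
    constructor
    · intro heD
      obtain ⟨x, ⟨hxU, hxA⟩, hx0, hxe⟩ := he heD
      exact ⟨_, ⟨hxA, hxU⟩, hxe⟩
    · rintro ⟨w, ⟨hwN, hwU⟩, rfl⟩
      exact hUU hwU hwN
  · have := (hB.self_of_nhds (φ 0) hφ.ne_zero).2 (by rw [hτ0])
    rwa [hz] at this
  · have h1 : ∀ᶠ w : ProjPlane × ProjPlane in 𝓝 (ofVec (ψ 0), z), _ :=
      (continuous_fst.tendsto _).eventually
        (hD.eventually_exists_eq (hB.and (hτ.eventually hφ.eventually_mem)))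
    filter_upwards [h1] with w hw hwD
    obtain ⟨x, ⟨hxB, hxN⟩, hx0, hxe⟩ := hw hwD.1
    have h2 := (hxB w.2.rep w.2.rep_nonzero).1 (by rwa [hxe, ofVec_rep])
    rw [ofVec_rep] at h2
    rw [h2]
    exact (mem_coneOver_iff.1 hxN.2).2
  · have hU' : ∀ᶠ x in 𝓝 0, (ofVec (ψ x), ofVec (φ (τ x))) ∈ U := by
      rw [← hz] at hU
      exact (((tendsto_ofVec hD.ne_zero).comp hψc).prodMk_nhds
        ((tendsto_ofVec hφ.ne_zero).comp hφτ)).eventually hU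
    filter_upwards [hφ.eventually_exists_eq (hσ.eventually (hU'.and hB))] with q hq
    constructor
    · intro hqN
      obtain ⟨t, ⟨htU, htB⟩, ht0, htq⟩ := hq hqN
      rw [hτσ] at htU htB
      exact ⟨_, ⟨(htB _ ht0).2 rfl, htU⟩, htq⟩
    · rintro ⟨w, ⟨hwN, hwU⟩, rfl⟩
      exact hUU hwU hwN

/-! ### Transversality to the projection, in homogeneous coordinates. -/

section

variable {E : Type*} [NormedAddCommGroup E] [NormedSpace ℝ E]

theorem IsTransverseToSnd.mem_span {M : Set (ProjPlane × ProjPlane)} {f g : E → HomCoord}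
    {f' g' : E →L[ℝ] HomCoord} {x : E}
    (hM : IsTransverseToSnd M (ofVec (f x)) (ofVec (g x)))
    (hf : HasFDerivAt f f' x) (hg : HasFDerivAt g g' x) (hf0 : f x ≠ 0) (hg0 : g x ≠ 0)
    (h : ∀ᶠ y in 𝓝 x, (ofVec (f y), ofVec (g y)) ∈ M) {ξ : E}
    (hξ : g' ξ ∈ Submodule.span ℂ {g x}) : f' ξ ∈ Submodule.span ℂ {f x} := by
  obtain ⟨a, ha, hfa⟩ := exists_smul_rep hf0
  obtain ⟨b, hb, hgb⟩ := exists_smul_rep hg0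
  have hd : HasFDerivAt (fun y ↦ (a • f y, b • g y)) ((a • f').prod (b • g')) x :=
    (hf.const_smul a).prodMk (hg.const_smul b)
  have hmem : (fun y ↦ (a • f y, b • g y)) ⁻¹' biconeOver M ∈ 𝓝 x := by
    filter_upwards [h, hf.continuousAt.eventually_ne hf0, hg.continuousAt.eventually_ne hg0]
      with y hy h1 h2
    rw [mem_preimage, mem_biconeOver_iff, ofVec_smul ha h1, ofVec_smul hb h2]
    exact ⟨smul_ne_zero ha h1, smul_ne_zero hb h2, hy⟩
  have h1 : (a • f' ξ, b • g' ξ) ∈ tangentConeAt ℝ (biconeOver M)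
      ((ofVec (f x)).rep, (ofVec (g x)).rep) := by
    rw [hfa, hgb]
    have h3 := (hd.hasFDerivWithinAt
      (s := (fun y ↦ (a • f y, b • g y)) ⁻¹' biconeOver M)).mapsTo_tangent_cone
    refine tangentConeAt_mono (image_preimage_subset _ _) (h3 (x := ξ) ?_)
    rw [tangentConeAt_of_mem_nhds hmem]
    trivial
  have h2 := hM _ (Submodule.subset_span h1)
  rw [hfa, hgb, Submodule.span_singleton_smul_eq ha.isUnit,
    Submodule.span_singleton_smul_eq hb.isUnit] at h2
  exact (Submodule.smul_mem_iff _ ha).1 (h2 (Submodule.smul_mem _ _ hξ))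

/-- The bicone is invariant under independent rescalings of its two factors, so any representatives
may be used. -/
theorem isTransverseToSnd_ofVec {M : Set (ProjPlane × ProjPlane)} {v l : HomCoord}
    (hv : v ≠ 0) (hl : l ≠ 0)
    (h : ∀ q ∈ Submodule.span ℝ (tangentConeAt ℝ (biconeOver M) (v, l)),
      q.2 ∈ Submodule.span ℂ {l} → q.1 ∈ Submodule.span ℂ {v}) :
    IsTransverseToSnd M (ofVec v) (ofVec l) := by
  obtain ⟨a, ha, hva⟩ := exists_smul_rep hv
  obtain ⟨b, hb, hlb⟩ := exists_smul_rep hl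
  rw [IsTransverseToSnd, hva, hlb, Submodule.span_singleton_smul_eq ha.isUnit,
    Submodule.span_singleton_smul_eq hb.isUnit]
  intro q hq hq2
  let L : HomCoord × HomCoord →L[ℝ] HomCoord × HomCoord := (smulL a⁻¹).prodMap (smulL b⁻¹)
  have hmaps : MapsTo L (biconeOver M) (biconeOver M) := by
    rintro ⟨x, y⟩ hxy
    rw [mem_biconeOver_iff] at hxy ⊢
    obtain ⟨h1, h2, h3⟩ := hxy
    refine ⟨smul_ne_zero (inv_ne_zero ha) h1, smul_ne_zero (inv_ne_zero hb) h2, ?_⟩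
    change (ofVec (a⁻¹ • x), ofVec (b⁻¹ • y)) ∈ M
    rwa [ofVec_smul (inv_ne_zero ha) h1, ofVec_smul (inv_ne_zero hb) h2]
  have hL : L (a • v, b • l) = (v, l) := by simp [L, smul_smul, ha, hb]
  have hmap : (Submodule.span ℝ (tangentConeAt ℝ (biconeOver M) (a • v, b • l))).map
      L.toLinearMap ≤ Submodule.span ℝ (tangentConeAt ℝ (biconeOver M) (v, l)) := by
    rw [Submodule.map_span_le]
    intro y hy
    have := map_mem_tangentConeAt L hmaps hy
    rw [hL] at this
    exact Submodule.subset_span this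
  have := h _ (hmap ⟨q, hq, rfl⟩) (Submodule.smul_mem _ b⁻¹ hq2)
  exact (Submodule.smul_mem_iff _ (inv_ne_zero ha)).1 this

end

/-! ### Projections onto a varying kernel. -/

section

variable {X F : Type*} [NormedAddCommGroup X] [NormedSpace ℝ X]
  [NormedAddCommGroup F] [NormedSpace ℝ F]

/-- For `A` near a left inverse of `S`, the projection onto the kernel of `A` that vanishes on the
range of `S`. -/
noncomputable def kerProj (S : F →L[ℝ] X) (A : X →L[ℝ] F) : X →L[ℝ] X :=
  ContinuousLinearMap.id ℝ X - S ∘L (A ∘L S).inverse ∘L A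

theorem kerProj_apply (S : F →L[ℝ] X) (A : X →L[ℝ] F) (y : X) :
    kerProj S A y = y - S ((A ∘L S).inverse (A y)) := rfl

theorem apply_kerProj {S : F →L[ℝ] X} {A : X →L[ℝ] F} (h : (A ∘L S).IsInvertible) (y : X) :
    A (kerProj S A y) = 0 := by
  have h1 := h.self_comp_inverse
  have h2 := DFunLike.congr_fun h1 (A y)
  rw [kerProj_apply, map_sub, sub_eq_zero]
  exact h2.symm

theorem kerProj_eq_self {S : F →L[ℝ] X} {A : X →L[ℝ] F} {y : X} (h : A y = 0) :
    kerProj S A y = y := by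
  rw [kerProj_apply, h, map_zero, map_zero, sub_zero]

theorem kerProj_apply_range {S : F →L[ℝ] X} {A : X →L[ℝ] F} (h : (A ∘L S).IsInvertible) (f : F) :
    kerProj S A (S f) = 0 := by
  have h2 := DFunLike.congr_fun h.inverse_comp_self f
  rw [kerProj_apply, sub_eq_zero]
  exact congrArg S h2.symm

/-- `kerProj S B` changes a vector only by an element of the range of `S`, which `kerProj S A`
kills. Hence `kerProj S A` and `kerProj S B` restrict to mutually inverse maps between the kernels
of `A` and `B` when both compositions with `S` are invertible. -/
theorem kerProj_kerProj {S : F →L[ℝ] X} {A B : X →L[ℝ] F} (h : (A ∘L S).IsInvertible) (y : X) :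
    kerProj S A (kerProj S B y) = kerProj S A y := by
  rw [kerProj_apply S B, map_sub, kerProj_apply_range h, sub_zero]

variable [CompleteSpace F]

theorem contDiffAt_kerProj {S : F →L[ℝ] X} {A : X →L[ℝ] F}
    (h : A ∘L S = ContinuousLinearMap.id ℝ F) {r : WithTop ℕ∞} :
    ContDiffAt ℝ r (kerProj S) A := by
  have h1 : ContDiffAt ℝ r (fun B : X →L[ℝ] F ↦ (B ∘L S).inverse) A := by
    have h2 : ContDiffAt ℝ r (ContinuousLinearMap.inverse : (F →L[ℝ] F) → _) (A ∘L S) := by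
      rw [h]
      exact contDiffAt_map_inverse (ContinuousLinearEquiv.refl ℝ F)
    exact ContDiffAt.comp A h2 (contDiffAt_id.clm_comp contDiffAt_const)
  exact contDiffAt_const.sub (contDiffAt_const.clm_comp (h1.clm_comp contDiffAt_id))

theorem eventually_isInvertible_comp {S : F →L[ℝ] X} {A : X →L[ℝ] F}
    (h : A ∘L S = ContinuousLinearMap.id ℝ F) : ∀ᶠ B in 𝓝 A, (B ∘L S).IsInvertible := by
  have hc : Continuous fun B : X →L[ℝ] F ↦ B ∘L S := continuous_id.clm_comp continuous_const
  have h1 := (ContinuousLinearEquiv.refl ℝ F).nhds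
  have h2 : Tendsto (fun B : X →L[ℝ] F ↦ B ∘L S) (𝓝 A)
      (𝓝 ((ContinuousLinearEquiv.refl ℝ F : F ≃L[ℝ] F) : F →L[ℝ] F)) :=
    hc.tendsto' _ _ h
  exact h2.eventually h1

end

/-! ### Conormal spaces and their dimension. -/

section

variable {E : Type*} [NormedAddCommGroup E] [NormedSpace ℝ E]

/-- The linear map whose kernel consists of the conormal vectors of `coneMap j`. -/
noncomputable def conormalMap :
    HomCoord × (E →L[ℝ] HomCoord) →L[ℝ] (HomCoord →L[ℝ] (ℂ × E →L[ℝ] ℝ)) :=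
  ((ContinuousLinearMap.compL ℝ HomCoord (HomCoord →L[ℝ] ℝ) (ℂ × E →L[ℝ] ℝ)).flip rePair) ∘L
    (ContinuousLinearMap.compL ℝ (ℂ × E) HomCoord ℝ).flip ∘L coneMap

theorem conormalMap_apply (j : HomCoord × (E →L[ℝ] HomCoord)) (l : HomCoord) :
    conormalMap j l = (rePair l) ∘L (coneMap j) := rfl

theorem isConormal_iff_conormalMap {j : HomCoord × (E →L[ℝ] HomCoord)} {l : HomCoord} :
    IsConormal j l ↔ conormalMap j l = 0 := Iff.rfl

theorem conormalMap_surjective {j : HomCoord × (E →L[ℝ] HomCoord)}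
    (hj : Function.Injective (coneMap j)) : Function.Surjective (conormalMap j) := by
  intro f
  obtain ⟨R, hR⟩ := LinearMap.exists_leftInverse_of_injective (coneMap j).toLinearMap
    (LinearMap.ker_eq_bot.2 hj)
  obtain ⟨l, hl⟩ := rePair_surjective (f ∘L LinearMap.toContinuousLinearMap R)
  refine ⟨l, ?_⟩
  rw [conormalMap_apply, hl]
  refine ContinuousLinearMap.ext fun x ↦ ?_
  exact congrArg f (LinearMap.congr_fun hR x)

variable [FiniteDimensional ℝ E]

theorem exists_conormalMap_rightInverse {j : HomCoord × (E →L[ℝ] HomCoord)}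
    (hj : Function.Injective (coneMap j)) : ∃ S : (ℂ × E →L[ℝ] ℝ) →L[ℝ] HomCoord,
      conormalMap j ∘L S = ContinuousLinearMap.id ℝ _ := by
  obtain ⟨S, hS⟩ := LinearMap.exists_rightInverse_of_surjective (conormalMap j).toLinearMap
    (LinearMap.range_eq_top.2 (conormalMap_surjective hj))
  exact ⟨LinearMap.toContinuousLinearMap S,
    ContinuousLinearMap.ext fun x ↦ LinearMap.congr_fun hS x⟩

theorem finrank_dual_complex_prod :
    Module.finrank ℝ (ℂ × E →L[ℝ] ℝ) = 2 + Module.finrank ℝ E := by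
  rw [← (LinearMap.toContinuousLinearMap (𝕜 := ℝ) (E := ℂ × E) (F' := ℝ)).finrank_eq]
  refine (Subspace.dual_finrank_eq (K := ℝ) (V := ℂ × E)).trans ?_
  rw [Module.finrank_prod, Complex.finrank_real_complex]

theorem finrank_conormal_add {j : HomCoord × (E →L[ℝ] HomCoord)}
    (hj : Function.Injective (coneMap j)) :
    (Module.finrank ℝ E + 2) + Module.finrank ℝ (conormalMap j).toLinearMap.ker = 6 := by
  have h := (conormalMap j).toLinearMap.finrank_range_add_finrank_ker
  rw [LinearMap.range_eq_top.2 (conormalMap_surjective hj), finrank_top, finrank_homCoord,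
    finrank_dual_complex_prod] at h
  omega

/-- For a real hypersurface the conormal space has dimension `6 - 2 - 3 = 1`. -/
theorem eq_smul_of_isConormal {j : HomCoord × (E →L[ℝ] HomCoord)}
    (hj : Function.Injective (coneMap j)) (hE : Module.finrank ℝ E = 3) {v w : HomCoord}
    (hv : IsConormal j v) (hw : IsConormal j w) (hw0 : w ≠ 0) : ∃ c : ℂ, v = c • w := by
  have h1 : Module.finrank ℝ (conormalMap j).toLinearMap.ker = 1 := by
    have := finrank_conormal_add hj
    omega
  have h2 := (finrank_eq_one_iff_of_nonzero' (⟨w, hw⟩ : (conormalMap j).toLinearMap.ker)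
    (fun h ↦ hw0 (congrArg Subtype.val h))).1 h1 ⟨v, hv⟩
  obtain ⟨c, hc⟩ := h2
  have h3 : c • w = v := congrArg Subtype.val hc
  exact ⟨c, by rw [← h3, Complex.coe_smul]⟩

end

theorem finrank_linePlane (d : ProjPlane) : Module.finrank ℝ (linePlane d) = 4 := by
  let f : HomCoord →ₗ[ℝ] ℂ := (dotL d.rep).toLinearMap
  have hf : ∀ x, f x = d.rep ⬝ᵥ x := fun x ↦ dotL_apply _ _
  have hker : linePlane d = f.ker := by
    ext x
    rw [LinearMap.mem_ker, hf, dotProduct_comm]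
    rfl
  have hsurj : Function.Surjective f := by
    intro c
    obtain ⟨i, hi⟩ := exists_ne_zero_apply d.rep_nonzero
    refine ⟨Pi.single i (c / d.rep i), ?_⟩
    rw [hf, dotProduct_single, mul_div_cancel₀ _ hi]
  have h := f.finrank_range_add_finrank_ker
  rw [LinearMap.range_eq_top.2 hsurj, finrank_top, finrank_homCoord,
    Complex.finrank_real_complex] at h
  rw [hker]
  omega

/-! ### General position excludes complex lines of conormals. -/

section

variable {k : ℕ} {φ : EuclideanSpace ℝ (Fin k) → HomCoord} {N : Set ProjPlane} {z : ProjPlane}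
  {r : WithTop ℕ∞}

theorem coneTangent_rep_eq_linePlane {v : HomCoord} {d : ProjPlane} (hv : v ≠ 0)
    (h : coneTangent N v = linePlane d) : coneTangent N (ofVec v).rep = linePlane d := by
  obtain ⟨c, hc, hvc⟩ := exists_smul_rep hv
  ext x
  have h1 : c • (c⁻¹ • x) = x := smul_inv_smul₀ hc x
  rw [hvc, ← h1, smul_mem_coneTangent_iff hc, h, ← ofVec_rep d,
    mem_linePlane_ofVec d.rep_nonzero, mem_linePlane_ofVec d.rep_nonzero, smul_dotProduct c,
    smul_eq_zero, or_iff_right hc]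

/-- If `l` and `i l` are both conormal then `l ⬝ dφ = 0`: the tangent space lies in the line `[l]`,
so `k ≤ 2`. For `k = 2` it is that complex line, which is excluded. For `k = 1` the line is tangent
to the curve, and it can be kept fixed to first order while the point moves, against transversality.
-/
theorem IsParametrization.not_isConormal_I_smul (h : IsParametrization r φ N z) (hr : 1 ≤ r)
    (hk : 1 ≤ k) {l : HomCoord} (hl : l ≠ 0)
    (hg : IsGeneralPosition N z (ofVec l)) (hc : IsConormal (φ 0, fderiv ℝ φ 0) l) :
    ¬ IsConormal (φ 0, fderiv ℝ φ 0) (Complex.I • l) := by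
  intro hc'
  have hdot : ∀ t, l ⬝ᵥ fderiv ℝ φ 0 t = 0 := fun t ↦ by
    have h1 := (isConormal_iff.1 hc).2 t
    have h2 := (isConormal_iff.1 hc').2 t
    simp only [smul_dotProduct, smul_eq_mul, Complex.mul_re, Complex.I_re, Complex.I_im, zero_mul,
      one_mul, zero_sub, neg_eq_zero] at h2
    exact Complex.ext h1 h2
  have hl0 : l ⬝ᵥ φ 0 = 0 := (isConormal_iff.1 hc).1
  have hT := (h.eventually_coneTangent hr).self_of_nhds
  have hle : coneTangent N (φ 0) ≤ linePlane (ofVec l) := by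
    rw [hT]
    rintro _ ⟨x, rfl⟩
    rw [mem_linePlane_ofVec hl, dotProduct_comm]
    simp [hl0, hdot, dotProduct_smul]
  have hrank : Module.finrank ℝ (coneTangent N (φ 0)) = 2 + k := by
    rw [hT, LinearMap.finrank_range_of_inj h.coneMap_injective, Module.finrank_prod,
      Complex.finrank_real_complex, finrank_euclideanSpace_fin]
  have hk4 : 2 + k ≤ 4 := by
    rw [← hrank, ← finrank_linePlane (ofVec l)]
    exact Submodule.finrank_mono hle
  obtain rfl | rfl : k = 2 ∨ k = 1 := by omega
  · have := Submodule.eq_of_le_of_finrank_eq hle (by rw [hrank, finrank_linePlane])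
    have := coneTangent_rep_eq_linePlane h.ne_zero this
    rw [h.ofVec_eq] at this
    exact hg.2.1 _ this
  -- The line `g t` is `l` corrected along one coordinate so as to pass through `φ t`. Its
  -- derivative at `0` vanishes because `l ⬝ φ` vanishes there to first order.
  · obtain ⟨i, hi⟩ := exists_ne_zero_apply h.ne_zero
    have hd0 := (h.eventually_differentiableAt hr).self_of_nhds
    set w : HomCoord := Pi.single i 1 with hw
    let p : EuclideanSpace ℝ (Fin 1) → ℂ := fun t ↦ l ⬝ᵥ φ t / φ t i
    let g : EuclideanSpace ℝ (Fin 1) → HomCoord := fun t ↦ l - p t • w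
    have hp0 : p 0 = 0 := by simp [p, hl0]
    have hg0 : g 0 = l := by simp [g, hp0]
    have hdφi : HasFDerivAt (fun t ↦ φ t i) (ContinuousLinearMap.proj i ∘L fderiv ℝ φ 0) 0 :=
      HasFDerivAt.comp (0 : EuclideanSpace ℝ (Fin 1))
        (ContinuousLinearMap.proj (R := ℝ) (φ := fun _ : Fin 3 ↦ ℂ) i).hasFDerivAt
        hd0.hasFDerivAt
    have hdl : HasFDerivAt (fun t ↦ l ⬝ᵥ φ t) (0 : EuclideanSpace ℝ (Fin 1) →L[ℝ] ℂ) 0 := by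
      have h1 : HasFDerivAt (fun t ↦ dotL l (φ t)) (dotL l ∘L fderiv ℝ φ 0) 0 :=
        HasFDerivAt.comp (0 : EuclideanSpace ℝ (Fin 1)) (dotL l).hasFDerivAt hd0.hasFDerivAt
      simp only [dotL_apply] at h1
      exact h1.congr_fderiv (ContinuousLinearMap.ext fun x ↦ by simp [hdot])
    have hinv : DifferentiableAt ℝ (fun t ↦ (φ t i)⁻¹) 0 := hdφi.differentiableAt.inv hi
    have hdp : HasFDerivAt p (0 : EuclideanSpace ℝ (Fin 1) →L[ℝ] ℂ) 0 := by
      have := hdl.mul hinv.hasFDerivAt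
      exact this.congr_fderiv (ContinuousLinearMap.ext fun x ↦ by simp [hl0])
    have hdg : HasFDerivAt g (0 : EuclideanSpace ℝ (Fin 1) →L[ℝ] HomCoord) 0 := by
      have := (hdp.smul_const w).const_sub l
      refine this.congr_fderiv (ContinuousLinearMap.ext fun x ↦ by simp)
    have hgφ : ∀ t, φ t i ≠ 0 → g t ⬝ᵥ φ t = 0 := fun t ht ↦ by
      simp only [g, p, hw]
      rw [sub_dotProduct, smul_dotProduct, single_one_dotProduct, smul_eq_mul,
        div_mul_cancel₀ _ ht, sub_self]
    have hmem : ∀ᶠ t in 𝓝 0, (ofVec (φ t), ofVec (g t)) ∈ liftSet N := by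
      filter_upwards [h.eventually_mem_liftSet_iff hr, hdφi.continuousAt.eventually_ne hi,
        hdg.continuousAt.eventually_ne (by rwa [hg0])] with t ht hti hgt
      rw [ht _ hgt]
      let e : EuclideanSpace ℝ (Fin 1) := EuclideanSpace.single 0 1
      let q : ℂ := g t ⬝ᵥ fderiv ℝ φ t e
      -- Every line through a point of a curve is non-transverse: conormality along the single
      -- tangent direction is one real equation on the complex factor `c`.
      obtain ⟨c, hc, hcq⟩ : ∃ c : ℂ, c ≠ 0 ∧ (c * q).re = 0 := by
        rcases eq_or_ne q 0 with hq | hq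
        · exact ⟨1, one_ne_zero, by simp [hq]⟩
        · refine ⟨Complex.I * (starRingEnd ℂ) q, by simpa using hq, ?_⟩
          simp
          ring
      refine ⟨c, hc, isConormal_iff.2 ⟨by rw [smul_dotProduct, hgφ t hti, smul_zero], fun x ↦ ?_⟩⟩
      have hx : x = x 0 • e := by
        ext j
        fin_cases j
        simp [e]
      rw [hx, map_smul, dotProduct_smul, smul_dotProduct, Complex.smul_re, smul_eq_mul c, hcq,
        smul_zero]
    have htr : IsTransverseToSnd (liftSet N) (ofVec (φ 0)) (ofVec (g 0)) := by
      rw [hg0, h.ofVec_eq]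
      exact hg.2.2
    have hspan := htr.mem_span hd0.hasFDerivAt hdg h.ne_zero (by rwa [hg0]) hmem
      (ξ := EuclideanSpace.single 0 1) (by simp)
    have := h.2.2.1 _ hspan
    simpa using congrArg (fun x : EuclideanSpace ℝ (Fin 1) ↦ x 0) this

end

/-! ### The `C^1` family of conormals and biduality for `k ≥ 1`. -/

section

variable {k : ℕ} {φ : EuclideanSpace ℝ (Fin k) → HomCoord} {N : Set ProjPlane} {z d : ProjPlane}
  {r : WithTop ℕ∞}

theorem IsParametrization.exists_isConormal (h : IsParametrization r φ N z) (hr : 1 ≤ r)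
    (hd : (z, d) ∈ liftSet N) : ∃ l ≠ 0, ofVec l = d ∧ IsConormal (φ 0, fderiv ℝ φ 0) l := by
  rw [← h.ofVec_eq, ← ofVec_rep d] at hd
  obtain ⟨c, hc, hcl⟩ :=
    ((h.eventually_mem_liftSet_iff hr).self_of_nhds _ d.rep_nonzero).1 hd
  exact ⟨c • d.rep, smul_ne_zero hc d.rep_nonzero,
    by rw [ofVec_smul hc d.rep_nonzero, ofVec_rep], hcl⟩

theorem contDiffAt_jet {E : Type*} [NormedAddCommGroup E] [NormedSpace ℝ E] {φ : E → HomCoord}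
    {x : E} (h : ContDiffAt ℝ 2 φ x) : ContDiffAt ℝ 1 (fun t ↦ (φ t, fderiv ℝ φ t)) x :=
  (h.of_le one_le_two).prodMk (h.fderiv_right (by norm_num [one_add_one_eq_two]))

theorem continuousAt_jet {E : Type*} [NormedAddCommGroup E] [NormedSpace ℝ E] {φ : E → HomCoord}
    {x : E} (h : ContDiffAt ℝ 1 φ x) : ContinuousAt (fun t ↦ (φ t, fderiv ℝ φ t)) x :=
  h.continuousAt.prodMk (h.continuousAt_fderiv one_ne_zero)

/-- Near `(φ 0, l)`, every pair in the lift of `N` has, for explicit continuous `t` and `c`, the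
conormal representative `(1 + c I) • y` at the parameter `t`. -/
theorem IsParametrization.exists_conormal_representative (h : IsParametrization 2 φ N z)
    {l : HomCoord} (hc : IsConormal (φ 0, fderiv ℝ φ 0) l)
    (hI : ¬ IsConormal (φ 0, fderiv ℝ φ 0) (Complex.I • l)) :
    ∃ (t : HomCoord → EuclideanSpace ℝ (Fin k)) (c : HomCoord × HomCoord → ℝ),
      ContinuousAt t (φ 0) ∧ t (φ 0) = 0 ∧ ContinuousAt c (φ 0, l) ∧ c (φ 0, l) = 0 ∧
      ∀ᶠ q in 𝓝 (φ 0, l), (ofVec q.1, ofVec q.2) ∈ liftSet N →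
        IsConormal (φ (t q.1), fderiv ℝ φ (t q.1)) ((1 + c q * Complex.I) • q.2) := by
  have hr : (1 : WithTop ℕ∞) ≤ 2 := one_le_two
  obtain ⟨G, hG, hG0, -, hGr⟩ := h.exists_chart hr
  have hl : l ≠ 0 := by
    rintro rfl
    rw [smul_zero] at hI
    exact hI hc
  let t : HomCoord → EuclideanSpace ℝ (Fin k) := fun v ↦ (G v).2
  have ht : ContinuousAt t (φ 0) := ContinuousAt.comp continuousAt_snd hG.continuousAt
  have ht0 : t (φ 0) = 0 := by simp [t, hG0]
  let A : EuclideanSpace ℝ (Fin k) → HomCoord →L[ℝ] (ℂ × EuclideanSpace ℝ (Fin k) →L[ℝ] ℝ) :=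
    fun s ↦ conormalMap (φ s, fderiv ℝ φ s)
  have hA : ContinuousAt A 0 :=
    ContinuousAt.comp (g := conormalMap (E := EuclideanSpace ℝ (Fin k)))
      (conormalMap (E := EuclideanSpace ℝ (Fin k))).continuous.continuousAt
      (contDiffAt_jet h.1).continuousAt
  -- If `(a + b i) y` is conormal, applying `χ` to its equation determines `b / a` as a quotient
  -- continuous near the base pair, whose denominator is close to `1`; in particular `a ≠ 0`.
  obtain ⟨χ, hχ⟩ : ∃ χ : (ℂ × EuclideanSpace ℝ (Fin k) →L[ℝ] ℝ) →L[ℝ] ℝ,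
      χ (A 0 (Complex.I • l)) = 1 := SeparatingDual.exists_eq_one hI
  have hAt : ContinuousAt (fun q : HomCoord × HomCoord ↦ A (t q.1)) (φ 0, l) := by
    have h1 : ContinuousAt (fun v ↦ A (t v)) (φ 0) :=
      ContinuousAt.comp (g := A) (by rwa [ht0]) ht
    exact ContinuousAt.comp (f := Prod.fst) (g := fun v ↦ A (t v)) h1 continuousAt_fst
  have ha : ContinuousAt (fun q : HomCoord × HomCoord ↦ χ (A (t q.1) q.2)) (φ 0, l) :=
    χ.continuous.continuousAt.comp (hAt.clm_apply continuousAt_snd)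
  have hb : ContinuousAt (fun q : HomCoord × HomCoord ↦ χ (A (t q.1) (Complex.I • q.2)))
      (φ 0, l) :=
    χ.continuous.continuousAt.comp (hAt.clm_apply
      ((continuous_const_smul Complex.I).continuousAt.comp continuousAt_snd))
  have hb0 : χ (A (t (φ 0)) (Complex.I • l)) = 1 := by rw [ht0, hχ]
  have ha0 : A (t (φ 0)) l = 0 := by rw [ht0]; exact hc
  refine ⟨t, fun q ↦ -(χ (A (t q.1) q.2) / χ (A (t q.1) (Complex.I • q.2))), ht, ht0,
    (ha.div hb (by simp [hb0])).neg, by simp [ha0], ?_⟩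
  have hfst : Tendsto (Prod.fst : HomCoord × HomCoord → HomCoord) (𝓝 (φ 0, l)) (𝓝 (φ 0)) :=
    continuousAt_fst
  have hsnd : Tendsto (Prod.snd : HomCoord × HomCoord → HomCoord) (𝓝 (φ 0, l)) (𝓝 l) :=
    continuousAt_snd
  have htt : Tendsto t (𝓝 (φ 0)) (𝓝 0) := by
    have : Tendsto t (𝓝 (φ 0)) (𝓝 (t (φ 0))) := ht
    rwa [ht0] at this
  have hbne : ∀ᶠ q : HomCoord × HomCoord in 𝓝 (φ 0, l),
      χ (A (t q.1) (Complex.I • q.2)) ≠ 0 := hb.eventually_ne (by simp [hb0])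
  filter_upwards [hbne, hfst.eventually hGr,
    hsnd.eventually (isOpen_ne.mem_nhds hl), hfst.eventually (isOpen_ne.mem_nhds h.ne_zero),
    (htt.comp hfst).eventually (h.eventually_mem_liftSet_iff hr)]
    with q hbq hGq hq2 hq1 hlift hq
  have hcone := hGq (mem_coneOver_iff.2 ⟨hq1, hq.1⟩)
  have hG1 : (G q.1).1 ≠ 0 := by
    intro h0
    rw [coneParam, h0, zero_smul] at hcone
    exact hq1 hcone.symm
  have hφt : φ (t q.1) ≠ 0 := by
    intro h0
    change (G q.1).1 • φ (t q.1) = q.1 at hcone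
    rw [h0, smul_zero] at hcone
    exact hq1 hcone.symm
  have hpt : ofVec q.1 = ofVec (φ (t q.1)) := (ofVec_eq_ofVec_iff hq1 hφt).2 ⟨_, hG1, hcone.symm⟩
  rw [hpt] at hq
  obtain ⟨c, hc0, hcl⟩ := (hlift q.2 hq2).1 hq
  have hlin : ∀ a b : ℝ, A (t q.1) (((a : ℂ) + b * Complex.I) • q.2) =
      a • A (t q.1) q.2 + b • A (t q.1) (Complex.I • q.2) := fun a b ↦ by
    rw [← map_smul, ← map_smul, ← map_add, add_smul, mul_smul, Complex.coe_smul, Complex.coe_smul]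
  have h1 : c.re • A (t q.1) q.2 + c.im • A (t q.1) (Complex.I • q.2) = 0 := by
    rw [← hlin, Complex.re_add_im]
    exact hcl
  have h2 := congrArg χ h1
  simp only [map_add, map_smul, smul_eq_mul, map_zero] at h2
  have hre : c.re ≠ 0 := by
    intro h0
    rw [h0, zero_mul, zero_add, mul_eq_zero, or_iff_left hbq] at h2
    exact hc0 (Complex.ext h0 h2)
  have h3 : -(χ (A (t q.1) q.2) / χ (A (t q.1) (Complex.I • q.2))) = c.im / c.re := by
    rw [← neg_div, div_eq_div_iff hbq hre]
    linear_combination -h2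
  have h4 := hlin 1 (c.im / c.re)
  rw [Complex.ofReal_one] at h4
  change A (t q.1) _ = 0
  beta_reduce
  rw [h3, h4]
  have h5 : (1 : ℝ) • A (t q.1) q.2 + (c.im / c.re) • A (t q.1) (Complex.I • q.2) =
      c.re⁻¹ • (c.re • A (t q.1) q.2 + c.im • A (t q.1) (Complex.I • q.2)) := by
    rw [smul_add, smul_smul, smul_smul, inv_mul_cancel₀ hre, div_eq_inv_mul]
  rw [h5, h1, smul_zero]

end

theorem fderiv_apply_of_affine {E F : Type*} [NormedAddCommGroup E] [NormedSpace ℝ E]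
    [NormedAddCommGroup F] [NormedSpace ℝ F] {f : E → F} (hf : DifferentiableAt ℝ f 0) {x : E}
    {a b : F} (h : ∀ r : ℝ, f (r • x) = a + r • b) : fderiv ℝ f 0 x = b := by
  have h0 : HasFDerivAt f (fderiv ℝ f 0) ((0 : ℝ) • x) := by
    rw [zero_smul]
    exact hf.hasFDerivAt
  have h1 : HasDerivAt (fun r : ℝ ↦ f (r • x)) (fderiv ℝ f 0 ((1 : ℝ) • x)) 0 :=
    h0.comp_hasDerivAt 0 ((hasDerivAt_id (0 : ℝ)).smul_const x)
  have h2 : HasDerivAt (fun r : ℝ ↦ f (r • x)) ((1 : ℝ) • b) 0 := by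
    simp only [h]
    exact ((hasDerivAt_id (0 : ℝ)).smul_const b).const_add a
  rw [← one_smul ℝ x, h1.unique h2, one_smul]

/-- Near `0` the conormal spaces are identified with the one at `0` by `kerProj`. Real scaling is
removed by the normalization `ρ = 1`, which leaves `k + (3 - k)` real parameters; since `i l` is not
conormal, no further redundancy comes from complex scaling. -/
theorem IsParametrization.exists_conormal_family {k : ℕ}
    {φ : EuclideanSpace ℝ (Fin k) → HomCoord} {N : Set ProjPlane} {z : ProjPlane}
    (h : IsParametrization 2 φ N z) {l : HomCoord} (hl : l ≠ 0)
    (hc : IsConormal (φ 0, fderiv ℝ φ 0) l)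
    (hI : ¬ IsConormal (φ 0, fderiv ℝ φ 0) (Complex.I • l)) :
    ∃ (ψ : EuclideanSpace ℝ (Fin 3) → HomCoord)
      (τ : EuclideanSpace ℝ (Fin 3) →L[ℝ] EuclideanSpace ℝ (Fin k))
      (σ : EuclideanSpace ℝ (Fin k) →L[ℝ] EuclideanSpace ℝ (Fin 3)),
      (∀ t, τ (σ t) = t) ∧ ContDiffAt ℝ 1 ψ 0 ∧ ψ 0 = l ∧
      (∀ x, τ x = 0 → fderiv ℝ ψ 0 x ∈ Submodule.span ℂ {l} → x = 0) ∧
      (∀ᶠ x in 𝓝 0, IsConormal (φ (τ x), fderiv ℝ φ (τ x)) (ψ x)) ∧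
      ∀ V ∈ 𝓝 (0 : EuclideanSpace ℝ (Fin 3)), ∀ᶠ q in 𝓝 (φ 0, l),
        (ofVec q.1, ofVec q.2) ∈ liftSet N → ∃ x ∈ V, ψ x ≠ 0 ∧ ofVec (ψ x) = ofVec q.2 := by
  obtain ⟨S, hS⟩ := exists_conormalMap_rightInverse h.coneMap_injective
  obtain ⟨ρ, hρ⟩ : ∃ ρ : HomCoord →L[ℝ] ℝ, ρ l = 1 := SeparatingDual.exists_eq_one hl
  let A : EuclideanSpace ℝ (Fin k) → HomCoord →L[ℝ] (ℂ × EuclideanSpace ℝ (Fin k) →L[ℝ] ℝ) :=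
    fun s ↦ conormalMap (φ s, fderiv ℝ φ s)
  have hAl : A 0 l = 0 := hc
  have hcm : ContDiff ℝ 1 (conormalMap (E := EuclideanSpace ℝ (Fin k))) :=
    ContinuousLinearMap.contDiff _
  have hA : ContDiffAt ℝ 1 A 0 := hcm.contDiffAt.comp 0 (contDiffAt_jet h.1)
  have hinv : ∀ᶠ t in 𝓝 0, ((A t) ∘L S).IsInvertible :=
    hA.continuousAt.eventually (eventually_isInvertible_comp hS)
  -- the complement of `ℝ l` in the conormal space at `0`
  let B : HomCoord →ₗ[ℝ] ((ℂ × EuclideanSpace ℝ (Fin k) →L[ℝ] ℝ) × ℝ) :=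
    (A 0).toLinearMap.prod ρ.toLinearMap
  have hBs : Function.Surjective B := by
    rintro ⟨f, a⟩
    refine ⟨S f + (a - ρ (S f)) • l, Prod.ext ?_ ?_⟩
    · change A 0 (S f + (a - ρ (S f)) • l) = f
      rw [map_add, map_smul, hAl, smul_zero, add_zero]
      exact DFunLike.congr_fun hS f
    · change ρ (S f + (a - ρ (S f)) • l) = a
      rw [map_add, map_smul, hρ, smul_eq_mul, mul_one, add_sub_cancel]
  have hB : ∀ {y}, y ∈ B.ker ↔ A 0 y = 0 ∧ ρ y = 0 := fun {y} ↦ by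
    rw [LinearMap.mem_ker]
    exact Prod.ext_iff
  have hfin : Module.finrank ℝ (EuclideanSpace ℝ (Fin 3)) =
      Module.finrank ℝ (EuclideanSpace ℝ (Fin k) × B.ker) := by
    have h1 := B.finrank_range_add_finrank_ker
    rw [LinearMap.range_eq_top.2 hBs, finrank_top, finrank_homCoord, Module.finrank_prod,
      finrank_dual_complex_prod, Module.finrank_self, finrank_euclideanSpace_fin] at h1
    rw [Module.finrank_prod, finrank_euclideanSpace_fin, finrank_euclideanSpace_fin]
    omega
  let e : EuclideanSpace ℝ (Fin 3) ≃L[ℝ] EuclideanSpace ℝ (Fin k) × B.ker :=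
    ContinuousLinearEquiv.ofFinrankEq hfin
  obtain ⟨p, hp⟩ := B.ker.subtype.exists_leftInverse_of_injective B.ker.ker_subtype
  let P : HomCoord →L[ℝ] B.ker := LinearMap.toContinuousLinearMap p
  have hP : ∀ y (hy : y ∈ B.ker), P y = ⟨y, hy⟩ := fun y hy ↦ LinearMap.congr_fun hp ⟨y, hy⟩
  let τ : EuclideanSpace ℝ (Fin 3) →L[ℝ] EuclideanSpace ℝ (Fin k) :=
    (ContinuousLinearMap.fst ℝ _ _) ∘L e.toContinuousLinearMap
  let κ : EuclideanSpace ℝ (Fin 3) →L[ℝ] HomCoord :=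
    B.ker.subtypeL ∘L (ContinuousLinearMap.snd ℝ _ _) ∘L e.toContinuousLinearMap
  let σ : EuclideanSpace ℝ (Fin k) →L[ℝ] EuclideanSpace ℝ (Fin 3) :=
    e.symm.toContinuousLinearMap ∘L ContinuousLinearMap.inl ℝ _ _
  have hτσ : ∀ t, τ (σ t) = t := fun t ↦ by simp [τ, σ]
  have hτ0 : τ 0 = 0 := map_zero τ
  have hκ : ∀ x, A 0 (κ x) = 0 ∧ ρ (κ x) = 0 := fun x ↦ hB.1 (e x).2.2
  have hker : ∀ x, τ x = 0 → κ x = 0 → x = 0 := fun x h1 h2 ↦ by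
    have h3 : e x = 0 := Prod.ext h1 (Subtype.ext h2)
    exact e.map_eq_zero_iff.1 h3
  have hτt : Tendsto τ (𝓝 0) (𝓝 0) := τ.continuous.tendsto' _ _ hτ0
  -- Over `τ x = 0` the vector `l + κ x` is already conormal and is not moved, so there `ψ` is
  -- affine with linear part `κ`.
  let ψ : EuclideanSpace ℝ (Fin 3) → HomCoord := fun x ↦ kerProj S (A (τ x)) (l + κ x)
  have hψ : ContDiffAt ℝ 1 ψ 0 := by
    have h1 : ContDiffAt ℝ 1 (fun x ↦ A (τ x)) 0 :=
      ContDiffAt.comp (g := A) 0 (by rwa [hτ0]) τ.contDiff.contDiffAt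
    have h2 : ContDiffAt ℝ 1 (fun x ↦ kerProj S (A (τ x))) 0 :=
      ContDiffAt.comp (g := kerProj S) 0 (contDiffAt_kerProj (by rw [hτ0]; exact hS)) h1
    exact h2.clm_apply (contDiffAt_const.add κ.contDiff.contDiffAt)
  have hψv : ∀ x, τ x = 0 → ψ x = l + κ x := fun x hx ↦ by
    change kerProj S (A (τ x)) (l + κ x) = _
    rw [hx, kerProj_eq_self (by rw [map_add, hAl, (hκ x).1, add_zero])]
  have hψ0 : ψ 0 = l := by rw [hψv 0 hτ0, map_zero, add_zero]
  have hDψ : ∀ x, τ x = 0 → fderiv ℝ ψ 0 x = κ x := fun x hx ↦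
    fderiv_apply_of_affine (hψ.differentiableAt one_ne_zero) (a := l) fun a ↦ by
      rw [hψv _ (by rw [map_smul, hx, smul_zero]), map_smul]
  refine ⟨ψ, τ, σ, hτσ, hψ, hψ0, fun x h3 hx ↦ ?_, ?_, fun V hV ↦ ?_⟩
  · rw [hDψ x h3] at hx
    obtain ⟨c, hcx⟩ := Submodule.mem_span_singleton.1 hx
    refine hker x h3 ?_
    have h4 : κ x = c.re • l + c.im • Complex.I • l := by
      rw [← hcx, ← Complex.coe_smul, ← Complex.coe_smul, smul_smul, ← add_smul, Complex.re_add_im]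
    have h5 : c.im = 0 := by
      have := (hκ x).1
      rw [h4, map_add, map_smul, map_smul, hAl, smul_zero, zero_add] at this
      exact (smul_eq_zero.1 this).resolve_right hI
    have h6 := (hκ x).2
    rw [h4, h5, zero_smul, add_zero, map_smul, hρ, smul_eq_mul, mul_one] at h6
    rw [h4, h5, h6, zero_smul, zero_smul, add_zero]
  · exact (hτt.eventually hinv).mono fun x hx ↦ apply_kerProj hx _
  · obtain ⟨t, c, ht, ht0, hcc, hc0, hrep⟩ := h.exists_conormal_representative hc hI
    have ht1 : ContinuousAt (fun q : HomCoord × HomCoord ↦ t q.1) (φ 0, l) :=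
      ContinuousAt.comp (f := Prod.fst) (g := t) ht continuousAt_fst
    let Y : HomCoord × HomCoord → HomCoord := fun q ↦ (1 + c q * Complex.I) • q.2
    have hY : ContinuousAt Y (φ 0, l) := by
      have h1 : ContinuousAt (fun q ↦ (c q : ℂ)) (φ 0, l) :=
        Complex.continuous_ofReal.continuousAt.comp hcc
      have h2 : ContinuousAt (fun q ↦ (1 + c q * Complex.I : ℂ)) (φ 0, l) :=
        continuousAt_const.add (h1.mul continuousAt_const)
      exact h2.smul continuousAt_snd
    have hY0 : Y (φ 0, l) = l := by simp [Y, hc0]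
    let K : HomCoord × HomCoord → HomCoord := fun q ↦ kerProj S (A 0) (Y q)
    have hK : ContinuousAt K (φ 0, l) := (kerProj S (A 0)).continuous.continuousAt.comp hY
    have hK0 : K (φ 0, l) = l := by
      change kerProj S (A 0) (Y (φ 0, l)) = l
      rw [hY0, kerProj_eq_self hAl]
    have hρK : ContinuousAt (fun q ↦ ρ (K q)) (φ 0, l) := ρ.continuous.continuousAt.comp hK
    have hρK0 : ρ (K (φ 0, l)) = 1 := by rw [hK0, hρ]
    -- The conormal representative is transported to the conormal space at `0` and scaled to `ρ =
    -- 1`; its difference with `l` lies in `B.ker` and gives the fibre coordinate. `kerProj_kerProj`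
    -- transports it back.
    let s : HomCoord × HomCoord → HomCoord := fun q ↦ (ρ (K q))⁻¹ • K q - l
    have hs : ContinuousAt s (φ 0, l) :=
      ((hρK.inv₀ (by rw [hρK0]; exact one_ne_zero)).smul hK).sub continuousAt_const
    have hs0 : s (φ 0, l) = 0 := by simp [s, hK0, hρ]
    let X : HomCoord × HomCoord → EuclideanSpace ℝ (Fin 3) := fun q ↦ e.symm (t q.1, P (s q))
    have hX : Tendsto X (𝓝 (φ 0, l)) (𝓝 0) := by
      have h1 : ContinuousAt X (φ 0, l) :=
        e.symm.continuous.continuousAt.comp (ht1.prodMk (P.continuous.continuousAt.comp hs))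
      have h2 : X (φ 0, l) = 0 := by
        simp only [X, hs0, ht0, map_zero]
        exact e.symm.map_zero
      rw [← h2]
      exact h1
    have hsnd : Tendsto (Prod.snd : HomCoord × HomCoord → HomCoord) (𝓝 (φ 0, l)) (𝓝 l) :=
      continuousAt_snd
    have hρne : ∀ᶠ q in 𝓝 (φ 0, l), ρ (K q) ≠ 0 :=
      hρK.eventually_ne (by rw [hρK0]; exact one_ne_zero)
    have htt : Tendsto (fun q : HomCoord × HomCoord ↦ t q.1) (𝓝 (φ 0, l)) (𝓝 0) := by
      have : Tendsto (fun q : HomCoord × HomCoord ↦ t q.1) (𝓝 (φ 0, l)) (𝓝 (t (φ 0))) := ht1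
      rwa [ht0] at this
    filter_upwards [hX.eventually hV, hrep, hρne, hsnd.eventually (isOpen_ne.mem_nhds hl),
      htt.eventually hinv] with q hXV hq hρq hq2 hinvq hlift
    have hYq : A (t q.1) (Y q) = 0 := hq hlift
    have hAK : A 0 (K q) = 0 := apply_kerProj hinv.self_of_nhds _
    have hsB : s q ∈ B.ker := by
      rw [hB]
      constructor
      · rw [map_sub, map_smul, hAK, hAl, smul_zero, sub_zero]
      · rw [map_sub, map_smul, hρ, smul_eq_mul, inv_mul_cancel₀ hρq, sub_self]
    have hτX : τ (X q) = t q.1 := by simp [τ, X]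
    have hκX : κ (X q) = s q := by
      have : κ (X q) = P (s q) := by simp [κ, X]
      rw [this, hP _ hsB]
    have hψX : ψ (X q) = (((ρ (K q))⁻¹ : ℝ) : ℂ) • (1 + c q * Complex.I) • q.2 := by
      change kerProj S (A (τ (X q))) (l + κ (X q)) = _
      rw [hτX, hκX, add_sub_cancel, map_smul, kerProj_kerProj hinvq, kerProj_eq_self hYq,
        Complex.coe_smul]
    have hc1 : (1 + c q * Complex.I : ℂ) ≠ 0 := fun h0 ↦ by
      simpa using congrArg Complex.re h0
    have hc2 : (((ρ (K q))⁻¹ : ℝ) : ℂ) ≠ 0 := by simpa using hρq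
    refine ⟨X q, hXV, ?_, ?_⟩
    · rw [hψX]
      exact smul_ne_zero hc2 (smul_ne_zero hc1 hq2)
    · rw [hψX, ofVec_smul hc2 (smul_ne_zero hc1 hq2), ofVec_smul hc1 hq2]

/-- A vector `x` with `dψ x` in the complex span of `ψ 0` has `τ x = 0`, by transversality and
because `φ` is an immersion, hence is zero along the fibre. So `[ψ]` is an immersion of three
parameters, and its conormals form a real line containing `φ ∘ τ`. -/
theorem exists_dualGerm_of_pos {k : ℕ} (hk : 1 ≤ k)
    {φ : EuclideanSpace ℝ (Fin k) → HomCoord} {N : Set ProjPlane} {z d : ProjPlane}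
    (h : IsParametrization 2 φ N z) (hg : IsGeneralPosition N z d) :
    ∃ D : Set ProjPlane, IsDualGerm N z d D ∧ IsSubmanifoldGerm 1 3 D d ∧ IsDualGerm D d z N := by
  have hr : (1 : WithTop ℕ∞) ≤ 2 := one_le_two
  obtain ⟨l, hl, rfl, hc⟩ := h.exists_isConormal hr hg.1
  have hI := h.not_isConormal_I_smul hr hk hl hg hc
  obtain ⟨ψ, τ, σ, hτσ, hψ, hψ0, hker, hcon, hcover⟩ := h.exists_conormal_family hl hc hI
  have hτ0 : τ 0 = 0 := map_zero τ
  have hτt : Tendsto τ (𝓝 0) (𝓝 0) := τ.continuous.tendsto' _ _ hτ0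
  have hmem : ∀ᶠ x in 𝓝 0, (ofVec (φ (τ x)), ofVec (ψ x)) ∈ liftSet N := by
    filter_upwards [hτt.eventually (h.eventually_mem_liftSet_iff hr), hcon,
      hψ.continuousAt.eventually_ne (by rwa [hψ0])] with x h1 h2 h3
    exact (h1 _ h3).2 ⟨1, one_ne_zero, by rwa [one_smul]⟩
  have hdφ := (h.eventually_differentiableAt hr).self_of_nhds
  have hi : Function.Injective (coneMap (ψ 0, fderiv ℝ ψ 0)) := by
    refine coneMap_injective_iff.2 ⟨by rwa [hψ0], fun x hx ↦ ?_⟩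
    have h1 : HasFDerivAt (fun y ↦ φ (τ y)) (fderiv ℝ φ 0 ∘L τ) 0 :=
      HasFDerivAt.comp (g := φ) 0 (by rw [hτ0]; exact hdφ.hasFDerivAt) τ.hasFDerivAt
    have htr : IsTransverseToSnd (liftSet N) (ofVec (φ (τ 0))) (ofVec (ψ 0)) := by
      rw [hψ0, hτ0, h.ofVec_eq]
      exact hg.2.2
    have h2 := IsTransverseToSnd.mem_span (f := fun y ↦ φ (τ y)) (g := ψ) htr h1
      (hψ.differentiableAt one_ne_zero).hasFDerivAt
      (by rw [hτ0]; exact h.ne_zero) (by rwa [hψ0]) hmem hx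
    rw [hτ0] at h2
    have h3 : τ x = 0 := h.2.2.1 _ h2
    exact hker x h3 (by rwa [hψ0] at hx)
  have huniq : ∀ᶠ x in 𝓝 0, ∀ v, IsConormal (ψ x, fderiv ℝ ψ x) v →
      ∃ c : ℂ, v = c • φ (τ x) := by
    have hinj : ∀ᶠ x in 𝓝 0, Function.Injective (coneMap (ψ x, fderiv ℝ ψ x)) := by
      have h1 : ContinuousAt (fun x ↦ coneMap (ψ x, fderiv ℝ ψ x)) 0 :=
        ContinuousAt.comp (g := coneMap (E := EuclideanSpace ℝ (Fin 3)))
          (coneMap (E := EuclideanSpace ℝ (Fin 3))).continuous.continuousAt (continuousAt_jet hψ)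
      exact h1.eventually (ContinuousLinearMap.isOpen_injective.mem_nhds hi)
    have hdψ : ∀ᶠ x in 𝓝 0, DifferentiableAt ℝ ψ x :=
      (hψ.eventually (by simp)).mono fun _ h ↦ h.differentiableAt one_ne_zero
    filter_upwards [hinj, hτt.eventually (h.eventually_differentiableAt hr), hdψ,
      hcon.eventually_nhds, hτt.eventually h.eventually_mem] with x h1 h2 h3 h4 h5 v hv
    exact eq_smul_of_isConormal h1 finrank_euclideanSpace_fin hv (isConormal_symm h2 h3
      h4.self_of_nhds (h4.mono fun y hy ↦ (isConormal_iff.1 hy).1)) h5.1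
  have := exists_dualGerm_of_parametrization h hr hτσ hψ hi hcon (by rwa [hψ0]) huniq
  rwa [hψ0] at this

/-! ### Biduality for a point. -/

theorem exists_dotProduct_eq_one {v : HomCoord} (hv : v ≠ 0) : ∃ w : HomCoord, w ⬝ᵥ v = 1 := by
  obtain ⟨i, hi⟩ := exists_ne_zero_apply hv
  exact ⟨Pi.single i (v i)⁻¹, by rw [single_dotProduct, inv_mul_cancel₀ hi]⟩

theorem exists_adapted_basis {v l : HomCoord} (hv : v ≠ 0) (hl : l ≠ 0) (hlv : l ⬝ᵥ v = 0) :
    ∃ b : Module.Basis (Fin 3) ℂ HomCoord, b 0 = l ∧ b 1 ⬝ᵥ v = 0 ∧ b 2 ⬝ᵥ v = 1 := by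
  obtain ⟨w, hw⟩ := exists_dotProduct_eq_one hv
  let f : HomCoord →ₗ[ℂ] ℂ := dotProductBilin ℂ ℂ v
  have hf : ∀ x, f x = x ⬝ᵥ v := fun x ↦ dotProduct_comm v x
  have hfs : Function.Surjective f := fun c ↦
    ⟨c • w, by rw [hf, smul_dotProduct, hw, smul_eq_mul, mul_one]⟩
  obtain ⟨u, huv, hul⟩ : ∃ u, u ⬝ᵥ v = 0 ∧ u ∉ Submodule.span ℂ {l} := by
    by_contra! h
    have hle : f.ker ≤ Submodule.span ℂ {l} := fun x hx ↦ h x (by rwa [← hf])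
    have h1 := Submodule.finrank_mono hle
    have h2 := f.finrank_range_add_finrank_ker
    rw [LinearMap.range_eq_top.2 hfs, finrank_top, Module.finrank_self,
      Module.finrank_fin_fun] at h2
    rw [finrank_span_singleton hl] at h1
    omega
  have hli : LinearIndependent ℂ ![l, u, w] := by
    rw [Fintype.linearIndependent_iff]
    intro g hg
    simp only [Fin.sum_univ_three, Matrix.cons_val] at hg
    have h2 : g 2 = 0 := by
      have := congrArg (fun x ↦ x ⬝ᵥ v) hg
      simpa [add_dotProduct, hlv, huv, hw] using this
    rw [h2, zero_smul, add_zero] at hg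
    have h1 : g 1 = 0 := by
      by_contra h1
      refine hul (Submodule.mem_span_singleton.2 ⟨-(g 0 / g 1), ?_⟩)
      rw [div_eq_inv_mul, neg_smul, mul_smul, eq_neg_of_add_eq_zero_left hg, smul_neg, neg_neg,
        inv_smul_smul₀ h1]
    rw [h1, zero_smul, add_zero] at hg
    have h0 : g 0 = 0 := (smul_eq_zero.1 hg).resolve_right hl
    intro i
    fin_cases i
    exacts [h0, h1, h2]
  refine ⟨basisOfLinearIndependentOfCardEqFinrank hli (by simp), ?_, ?_, ?_⟩ <;>
    simp [huv, hw]

/-- The lines through `z` near `d` are `[b 0 + ζ • b 1]` with `ζ` complex. A conormal of this family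
is orthogonal to both `b 0` and `b 1`, hence is a multiple of `φ 0`. -/
theorem exists_dualGerm_of_point {φ : EuclideanSpace ℝ (Fin 0) → HomCoord} {N : Set ProjPlane}
    {z d : ProjPlane} (h : IsParametrization 2 φ N z) (hd : (z, d) ∈ liftSet N) :
    ∃ D : Set ProjPlane, IsDualGerm N z d D ∧ IsSubmanifoldGerm 1 2 D d ∧ IsDualGerm D d z N := by
  have hr : (1 : WithTop ℕ∞) ≤ 2 := one_le_two
  obtain ⟨l, hl, rfl, hc⟩ := h.exists_isConormal hr hd
  have hlφ : l ⬝ᵥ φ 0 = 0 := (isConormal_iff.1 hc).1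
  obtain ⟨b, rfl, hu, hw⟩ := exists_adapted_basis h.ne_zero hl hlφ
  have hexp : ∀ y : HomCoord, y ⬝ᵥ φ 0 = 0 → y = b.repr y 0 • b 0 + b.repr y 1 • b 1 := by
    intro y hy
    have h1 := b.sum_repr y
    rw [Fin.sum_univ_three] at h1
    have h2 := congrArg (fun x ↦ x ⬝ᵥ φ 0) h1
    simp only [add_dotProduct, smul_dotProduct, hlφ, hu, hw, hy, mul_zero, zero_add, smul_eq_mul,
      mul_one] at h2
    rw [h2, zero_smul, add_zero] at h1
    exact h1.symm
  let ζ : EuclideanSpace ℝ (Fin 2) →L[ℝ] ℂ := LinearMap.toContinuousLinearMap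
    { toFun := fun x ↦ (x 0 : ℂ) + x 1 * Complex.I
      map_add' := fun x y ↦ by simp; ring
      map_smul' := fun c x ↦ by simp; ring }
  have hζ : ∀ x, ζ x = (x 0 : ℂ) + x 1 * Complex.I := fun _ ↦ rfl
  have hζ0 : ∀ x, ζ x = 0 → x = 0 := fun x hx ↦ by
    rw [hζ] at hx
    have h1 := congrArg Complex.re hx
    have h2 := congrArg Complex.im hx
    simp at h1 h2
    ext i
    fin_cases i
    exacts [h1, h2]
  let L : EuclideanSpace ℝ (Fin 2) →L[ℝ] HomCoord := ζ.smulRight (b 1)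
  have hL : ∀ x, L x = ζ x • b 1 := fun _ ↦ rfl
  let ψ : EuclideanSpace ℝ (Fin 2) → HomCoord := fun x ↦ b 0 + L x
  have hψ0 : ψ 0 = b 0 := by simp [ψ]
  have hψ : ContDiffAt ℝ 1 ψ 0 := contDiffAt_const.add L.contDiff.contDiffAt
  have hDψ : ∀ x, fderiv ℝ ψ x = L := fun x ↦ (L.hasFDerivAt.const_add (b 0)).fderiv
  have hi : Function.Injective (coneMap (ψ 0, fderiv ℝ ψ 0)) := by
    refine coneMap_injective_iff.2 ⟨by rwa [hψ0], fun x hx ↦ ?_⟩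
    rw [hDψ, hψ0, hL] at hx
    obtain ⟨c, hcx⟩ := Submodule.mem_span_singleton.1 hx
    have := congrArg (fun y ↦ b.repr y 1) hcx
    simp at this
    exact hζ0 x this.symm
  have hcon : ∀ x, IsConormal (φ 0, fderiv ℝ φ 0) (ψ x) := fun x ↦ by
    refine isConormal_iff.2 ⟨?_, fun t ↦ ?_⟩
    · simp [ψ, hL, add_dotProduct, hlφ, hu]
    · rw [Subsingleton.elim t 0, map_zero, dotProduct_zero, Complex.zero_re]
  have huniq : ∀ x v, IsConormal (ψ x, fderiv ℝ ψ x) v → ∃ c : ℂ, v = c • φ 0 := by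
    intro x v hv
    rw [isConormal_iff, hDψ] at hv
    have h1 : v ⬝ᵥ b 1 = 0 := by
      have h2 := hv.2 (EuclideanSpace.single 0 1)
      have h3 := hv.2 (EuclideanSpace.single 1 1)
      simp [hL, hζ, dotProduct_smul] at h2 h3
      exact Complex.ext h2 h3
    have h0 : v ⬝ᵥ b 0 = 0 := by
      have := hv.1
      simpa [ψ, hL, dotProduct_add, dotProduct_smul, h1] using this
    refine exists_eq_smul_of_rePair_eq_zero h.ne_zero fun y hy ↦ ?_
    rw [hexp y hy, rePair_apply, dotProduct_add, dotProduct_smul, dotProduct_smul, h0, h1]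
    simp
  have hcover : ∀ V ∈ 𝓝 (0 : EuclideanSpace ℝ (Fin 2)), ∀ᶠ q in 𝓝 (φ 0, ψ 0),
      (ofVec q.1, ofVec q.2) ∈ liftSet N → ∃ x ∈ V, ψ x ≠ 0 ∧ ofVec (ψ x) = ofVec q.2 := by
    intro V hV
    rw [hψ0]
    have hcoord : ∀ i, Continuous fun y ↦ b.repr y i := fun i ↦
      (b.coord i).continuous_of_finiteDimensional
    let X : HomCoord → EuclideanSpace ℝ (Fin 2) := fun y ↦
      !₂[(b.repr y 1 / b.repr y 0).re, (b.repr y 1 / b.repr y 0).im]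
    have hX : Tendsto X (𝓝 (b 0)) (𝓝 0) := by
      have h1 : ContinuousAt (fun y ↦ b.repr y 1 / b.repr y 0) (b 0) :=
        (hcoord 1).continuousAt.div (hcoord 0).continuousAt (by simp)
      have h2 : ContinuousAt X (b 0) := by
        refine (PiLp.continuous_toLp 2 _).continuousAt.comp (continuousAt_pi.2 fun i ↦ ?_)
        fin_cases i
        · exact Complex.continuous_re.continuousAt.comp h1
        · exact Complex.continuous_im.continuousAt.comp h1
      have h3 : X (b 0) = 0 := by
        ext i
        fin_cases i <;> simp [X]
      rw [← h3]
      exact h2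
    have hζX : ∀ y, ζ (X y) = b.repr y 1 / b.repr y 0 := fun y ↦ Complex.re_add_im _
    have hfst : Tendsto (Prod.fst : HomCoord × HomCoord → HomCoord) (𝓝 (φ 0, b 0)) (𝓝 (φ 0)) :=
      continuousAt_fst
    have hsnd : Tendsto (Prod.snd : HomCoord × HomCoord → HomCoord) (𝓝 (φ 0, b 0)) (𝓝 (b 0)) :=
      continuousAt_snd
    have hne : ∀ᶠ y in 𝓝 (b 0), b.repr y 0 ≠ 0 :=
      (hcoord 0).continuousAt.eventually_ne (by simp)
    filter_upwards [(hX.comp hsnd).eventually hV, hsnd.eventually hne,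
      hsnd.eventually (isOpen_ne.mem_nhds hl), hfst.eventually (isOpen_ne.mem_nhds h.ne_zero),
      hfst.eventually (h.eventually_exists univ_mem)] with q hXV hq0 hq2 hq1 hq hlift
    obtain ⟨t, -, -, htq⟩ := hq (mem_coneOver_iff.2 ⟨hq1, hlift.1⟩)
    rw [Subsingleton.elim t 0] at htq
    have horth : q.2 ⬝ᵥ φ 0 = 0 := by
      have h1 : (ofVec q.1).orthogonal (ofVec q.2) := hlift.2.1
      rw [← htq, orthogonal_ofVec h.ne_zero hq2, dotProduct_comm] at h1
      exact h1
    have hψX : ψ (X q.2) = (b.repr q.2 0)⁻¹ • q.2 := by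
      have h1 := congrArg (fun y ↦ (b.repr q.2 0)⁻¹ • y) (hexp _ horth)
      refine Eq.trans ?_ h1.symm
      rw [smul_add, inv_smul_smul₀ hq0, smul_smul, ← div_eq_inv_mul]
      change b 0 + L (X q.2) = _
      rw [hL, hζX]
    refine ⟨X q.2, hXV, ?_, ?_⟩
    · rw [hψX]
      exact smul_ne_zero (inv_ne_zero hq0) hq2
    · rw [hψX, ofVec_smul (inv_ne_zero hq0) hq2]
  have h0 : ∀ t : EuclideanSpace ℝ (Fin 0), t = 0 := fun t ↦ Subsingleton.elim _ _
  have := exists_dualGerm_of_parametrization h hr (τ := 0) (σ := 0)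
    (fun t ↦ Subsingleton.elim _ _) hψ hi (Eventually.of_forall hcon) hcover
    (Eventually.of_forall huniq)
  rwa [hψ0] at this

/-! ### Segments of linear maps. -/

theorem finite_not_injective_segment {X Y : Type*} [NormedAddCommGroup X] [NormedSpace ℝ X]
    [FiniteDimensional ℝ X] [NormedAddCommGroup Y] [NormedSpace ℝ Y] (A B : X →L[ℝ] Y)
    (hB : Function.Injective B) :
    {s : ℝ | ¬ Function.Injective (A + s • (B - A))}.Finite := by
  obtain ⟨R, hR⟩ := LinearMap.exists_leftInverse_of_injective B.toLinearMap
    (LinearMap.ker_eq_bot.2 hB)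
  have hRB : ∀ x, R (B x) = x := fun x ↦ LinearMap.congr_fun hR x
  let T : Module.End ℝ X := R ∘ₗ A.toLinearMap
  have hfin : {a : ℝ | Module.End.HasEigenvalue T a}.Finite := Module.End.finite_hasEigenvalue T
  have hne : ∀ s : ℝ, ¬ Function.Injective (A + s • (B - A)) → s - 1 ≠ 0 := by
    intro s hs h
    rw [sub_eq_zero.1 h, one_smul, add_sub_cancel] at hs
    exact hs hB
  -- Applying the left inverse `R` of `B` to `(A + s (B - A)) x = 0` gives `(s - 1) R A x = s x`, so
  -- `s / (s - 1)` is an eigenvalue of `R A`; the value `s = 1` gives `B` itself and is not in the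
  -- set.
  refine Set.Finite.of_injOn (f := fun s : ℝ ↦ s / (s - 1)) ?_ ?_ hfin
  · intro s hs
    have hs' := hs
    rw [mem_ofPred_eq, injective_iff_map_eq_zero] at hs'
    push Not at hs'
    obtain ⟨x, hx, hx0⟩ := hs'
    refine Module.End.hasEigenvalue_of_hasEigenvector (x := x)
      ⟨Module.End.mem_eigenspace_iff.2 ?_, hx0⟩
    have h1 := congrArg R hx
    simp only [add_apply, smul_apply,
      sub_apply, map_add, map_smul, map_sub, hRB, map_zero] at h1
    have h2 : (s - 1) • R (A x) = s • x := by
      rw [← sub_eq_zero, ← neg_eq_zero, ← h1]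
      module
    have h3 : T x = R (A x) := rfl
    beta_reduce
    rw [h3, div_eq_inv_mul, mul_smul, ← h2, inv_smul_smul₀ (hne s hs)]
  · intro s hs t ht hst
    have hst' : s / (s - 1) = t / (t - 1) := hst
    rw [div_eq_div_iff (hne s hs) (hne t ht)] at hst'
    linarith

theorem eventually_notMem_of_finite {F : Set ℝ} (hF : F.Finite) :
    ∀ᶠ s in 𝓝[≠] (0 : ℝ), s ∉ F := by
  have h1 : (F \ {0})ᶜ ∈ 𝓝 (0 : ℝ) :=
    (hF.subset sdiff_subset).isClosed.isOpen_compl.mem_nhds (by simp)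
  filter_upwards [nhdsWithin_le_nhds h1, self_mem_nhdsWithin] with s hs hs0 hsF
  exact hs ⟨hsF, hs0⟩

/-- The imaginary part of the pairing with `l`. -/
noncomputable def imPair : HomCoord →L[ℝ] HomCoord →L[ℝ] ℝ :=
  (ContinuousLinearMap.compL ℝ HomCoord ℂ ℝ Complex.imCLM) ∘L dotL

@[simp] theorem imPair_apply (x y : HomCoord) : imPair x y = (x ⬝ᵥ y).im := by
  simp [imPair]

/-! ### The bordered second fundamental form. -/

section

variable {E : Type*} [NormedAddCommGroup E] [NormedSpace ℝ E]

/-- The real part of `l ⬝ Q`, a quadratic form, bordered by the imaginary part of `l ⬝ L`. -/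
noncomputable def borderedMap (L : E →L[ℝ] HomCoord) (Q : E →L[ℝ] E →L[ℝ] HomCoord)
    (l : HomCoord) : E × ℝ →L[ℝ] (E →L[ℝ] ℝ) × ℝ :=
  (ContinuousLinearMap.inl ℝ _ _) ∘L
    ((ContinuousLinearMap.compL ℝ E HomCoord ℝ (rePair l)) ∘L Q ∘L ContinuousLinearMap.fst ℝ E ℝ -
      ((ContinuousLinearMap.lsmul ℝ ℝ).flip (imPair l ∘L L)) ∘L ContinuousLinearMap.snd ℝ E ℝ) +
  (ContinuousLinearMap.inr ℝ _ _) ∘L (imPair l ∘L L) ∘L ContinuousLinearMap.fst ℝ E ℝ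

theorem borderedMap_fst (L : E →L[ℝ] HomCoord) (Q : E →L[ℝ] E →L[ℝ] HomCoord)
    (l : HomCoord) (x : E × ℝ) (y : E) :
    (borderedMap L Q l x).1 y = (l ⬝ᵥ Q x.1 y).re - x.2 * (l ⬝ᵥ L y).im := by
  simp [borderedMap]

theorem borderedMap_snd (L : E →L[ℝ] HomCoord) (Q : E →L[ℝ] E →L[ℝ] HomCoord)
    (l : HomCoord) (x : E × ℝ) : (borderedMap L Q l x).2 = (l ⬝ᵥ L x.1).im := by
  simp [borderedMap]

theorem continuous_borderedMap :
    Continuous fun j : (E →L[ℝ] HomCoord) × (E →L[ℝ] E →L[ℝ] HomCoord) × HomCoord ↦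
      borderedMap j.1 j.2.1 j.2.2 := by
  have hre : Continuous fun j : (E →L[ℝ] HomCoord) × (E →L[ℝ] E →L[ℝ] HomCoord) × HomCoord ↦
      ContinuousLinearMap.compL ℝ E HomCoord ℝ (rePair j.2.2) :=
    (ContinuousLinearMap.continuous _).comp
      (rePair.continuous.comp (continuous_snd.comp continuous_snd))
  have him : Continuous fun j : (E →L[ℝ] HomCoord) × (E →L[ℝ] E →L[ℝ] HomCoord) × HomCoord ↦
      imPair j.2.2 ∘L j.1 :=
    (imPair.continuous.comp (continuous_snd.comp continuous_snd)).clm_comp continuous_fst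
  exact (continuous_const.clm_comp
      ((hre.clm_comp ((continuous_fst.comp continuous_snd).clm_comp continuous_const)).sub
        (((ContinuousLinearMap.continuous _).comp him).clm_comp continuous_const))).add
    (continuous_const.clm_comp (him.clm_comp continuous_const))

theorem borderedMap_segment_right (L : E →L[ℝ] HomCoord) (Q : E →L[ℝ] E →L[ℝ] HomCoord)
    (l l' : HomCoord) (s : ℝ) : borderedMap L Q (l + s • (l' - l)) =
      borderedMap L Q l + s • (borderedMap L Q l' - borderedMap L Q l) := by
  refine ContinuousLinearMap.ext fun x ↦ Prod.ext (ContinuousLinearMap.ext fun y ↦ ?_) ?_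
  · simp [borderedMap_fst, add_dotProduct, sub_dotProduct, smul_dotProduct]
    ring
  · simp [borderedMap_snd, add_dotProduct, sub_dotProduct, smul_dotProduct]

theorem borderedMap_segment_left (L L' : E →L[ℝ] HomCoord) (Q Q' : E →L[ℝ] E →L[ℝ] HomCoord)
    (l : HomCoord) (s : ℝ) : borderedMap (L + s • (L' - L)) (Q + s • (Q' - Q)) l =
      borderedMap L Q l + s • (borderedMap L' Q' l - borderedMap L Q l) := by
  refine ContinuousLinearMap.ext fun x ↦ Prod.ext (ContinuousLinearMap.ext fun y ↦ ?_) ?_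
  · simp [borderedMap_fst, dotProduct_add, dotProduct_sub, dotProduct_smul]
    ring
  · simp [borderedMap_snd, dotProduct_add, dotProduct_sub, dotProduct_smul]

end

/-- Equations satisfied by a set linearize on its tangent vectors; only this inclusion is needed to
prove transversality. -/
theorem fderiv_eq_zero_of_mem_span_tangentConeAt {E F : Type*} [NormedAddCommGroup E]
    [NormedSpace ℝ E] [NormedAddCommGroup F] [NormedSpace ℝ F] {S : Set E} {x q : E} {f : E → F}
    {f' : E →L[ℝ] F} (hf : HasFDerivAt f f' x) (hx : f x = 0)
    (h : ∀ᶠ y in 𝓝 x, y ∈ S → f y = 0) (hq : q ∈ Submodule.span ℝ (tangentConeAt ℝ S x)) :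
    f' q = 0 := by
  have h1 : HasFDerivWithinAt f (0 : E →L[ℝ] F) S x :=
    (hasFDerivWithinAt_const (0 : F) x S).congr_of_eventuallyEq
      (eventually_nhdsWithin_iff.2 h) hx
  have hle : Submodule.span ℝ (tangentConeAt ℝ S x) ≤ f'.toLinearMap.ker :=
    Submodule.span_le.2 fun y hy ↦ hf.hasFDerivWithinAt.unique_on h1 hy
  exact hle hq

/-- Both `p` and `q` lie on the real line of numbers `w` with `Re (c w) = 0`, so they are
real-dependent. This eliminates the unknown factor that makes a line's representative conormal. -/
theorem re_mul_im_sub_eq_zero {c p q : ℂ} (hc : c ≠ 0) (hp : (c * p).re = 0)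
    (hq : (c * q).re = 0) : p.re * q.im - q.re * p.im = 0 := by
  rw [Complex.mul_re] at hp hq
  have h1 : c.re * (p.re * q.im - q.re * p.im) = 0 := by
    linear_combination q.im * hp - p.im * hq
  have h2 : c.im * (p.re * q.im - q.re * p.im) = 0 := by
    linear_combination q.re * hp - p.re * hq
  by_contra h
  exact hc (Complex.ext ((mul_eq_zero.1 h1).resolve_right h) ((mul_eq_zero.1 h2).resolve_right h))

/-! ### Linear equations for tangent vectors of the lift. -/

section

variable {k : ℕ} {φ : EuclideanSpace ℝ (Fin k) → HomCoord} {N : Set ProjPlane} {z : ProjPlane}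
  {r : WithTop ℕ∞}

/-- Tangent vectors of the lift of `N` project to tangent vectors of `N`; the parameters are the
derivative of a local inverse `G` of the parametrization of the cone. -/
theorem IsParametrization.coneMap_fderiv_eq (h : IsParametrization r φ N z) (hr : 1 ≤ r)
    {G : HomCoord → ℂ × EuclideanSpace ℝ (Fin k)} (hG : ContDiffAt ℝ 1 G (φ 0))
    (hG0 : G (φ 0) = (1, 0)) (hGr : ∀ᶠ v in 𝓝 (φ 0), v ∈ coneOver N → coneParam φ (G v) = v)
    {l : HomCoord} {q : HomCoord × HomCoord}
    (hq : q ∈ Submodule.span ℝ (tangentConeAt ℝ (biconeOver (liftSet N)) (φ 0, l))) :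
    coneMap (φ 0, fderiv ℝ φ 0) (fderiv ℝ G (φ 0) q.1) = q.1 := by
  have hF := hasFDerivAt_coneParam (h.eventually_differentiableAt hr).self_of_nhds
  have h1 : HasFDerivAt (fun v ↦ coneParam φ (G v))
      (coneMap (φ 0, fderiv ℝ φ 0) ∘L fderiv ℝ G (φ 0)) (φ 0) :=
    HasFDerivAt.comp (g := coneParam φ) (φ 0) (by rwa [hG0])
      (hG.differentiableAt one_ne_zero).hasFDerivAt
  have h2 : HasFDerivAt (fun q : HomCoord × HomCoord ↦ coneParam φ (G q.1) - q.1)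
      ((coneMap (φ 0, fderiv ℝ φ 0) ∘L fderiv ℝ G (φ 0) - ContinuousLinearMap.id ℝ HomCoord) ∘L
        ContinuousLinearMap.fst ℝ _ _) (φ 0, l) :=
    HasFDerivAt.comp (g := fun v ↦ coneParam φ (G v) - v) (φ 0, l)
      (h1.sub (hasFDerivAt_id _)) hasFDerivAt_fst
  have hfst : Tendsto (Prod.fst : HomCoord × HomCoord → HomCoord) (𝓝 (φ 0, l)) (𝓝 (φ 0)) :=
    continuousAt_fst
  have h3 := fderiv_eq_zero_of_mem_span_tangentConeAt h2 (by simp [hG0, coneParam]) (by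
    filter_upwards [hfst.eventually hGr] with p hp hpS
    rw [mem_biconeOver_iff] at hpS
    exact sub_eq_zero.2 (hp (mem_coneOver_iff.2 ⟨hpS.1, hpS.2.2.1⟩))) hq
  exact sub_eq_zero.1 h3

theorem dotProduct_add_eq_zero_of_mem_span_tangentConeAt {v l : HomCoord} (hvl : v ⬝ᵥ l = 0)
    {q : HomCoord × HomCoord}
    (hq : q ∈ Submodule.span ℝ (tangentConeAt ℝ (biconeOver (liftSet N)) (v, l))) :
    v ⬝ᵥ q.2 + q.1 ⬝ᵥ l = 0 := by
  have h1 : HasFDerivAt (fun q : HomCoord × HomCoord ↦ dotL q.1 q.2) _ (v, l) :=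
    dotL.hasFDerivAt_of_bilinear hasFDerivAt_fst hasFDerivAt_snd
  have h2 := fderiv_eq_zero_of_mem_span_tangentConeAt h1 (by simpa using hvl)
    (Eventually.of_forall fun p hp ↦ ?_) hq
  · simpa using h2
  · rw [mem_biconeOver_iff] at hp
    have := hp.2.2.2.1
    rw [orthogonal_ofVec hp.1 hp.2.1] at this
    simpa using this

/-- On the lift the numbers `p s = y ⬝ dφ s`, with `y` a representative of the line, all lie on one
real line, so `Re (p s) Im (p s') = Re (p s') Im (p s)`. This is differentiated at the base pair,
where the real parts vanish. -/
theorem IsParametrization.bordered_relation (h : IsParametrization 2 φ N z)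
    {G : HomCoord → ℂ × EuclideanSpace ℝ (Fin k)} (hG : ContDiffAt ℝ 1 G (φ 0))
    (hG0 : G (φ 0) = (1, 0)) (hGr : ∀ᶠ v in 𝓝 (φ 0), v ∈ coneOver N → coneParam φ (G v) = v)
    {l : HomCoord} (hc : IsConormal (φ 0, fderiv ℝ φ 0) l) {q : HomCoord × HomCoord}
    (hq : q ∈ Submodule.span ℝ (tangentConeAt ℝ (biconeOver (liftSet N)) (φ 0, l)))
    (s s' : EuclideanSpace ℝ (Fin k)) :
    (l ⬝ᵥ fderiv ℝ (fderiv ℝ φ) 0 (fderiv ℝ G (φ 0) q.1).2 s + q.2 ⬝ᵥ fderiv ℝ φ 0 s).re *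
        (l ⬝ᵥ fderiv ℝ φ 0 s').im =
      (l ⬝ᵥ fderiv ℝ (fderiv ℝ φ) 0 (fderiv ℝ G (φ 0) q.1).2 s' + q.2 ⬝ᵥ fderiv ℝ φ 0 s').re *
        (l ⬝ᵥ fderiv ℝ φ 0 s).im := by
  have hr : (1 : WithTop ℕ∞) ≤ 2 := one_le_two
  have hre : ∀ s, (l ⬝ᵥ fderiv ℝ φ 0 s).re = 0 := (isConormal_iff.1 hc).2
  have hdd : HasFDerivAt (fderiv ℝ φ) (fderiv ℝ (fderiv ℝ φ) 0) 0 :=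
    ((h.1.fderiv_right (m := 1) (by norm_num [one_add_one_eq_two])).differentiableAt
      one_ne_zero).hasFDerivAt
  have ht : HasFDerivAt (fun q : HomCoord × HomCoord ↦ (G q.1).2)
      (ContinuousLinearMap.snd ℝ _ _ ∘L fderiv ℝ G (φ 0) ∘L ContinuousLinearMap.fst ℝ _ _)
      (φ 0, l) := by
    have h1 : HasFDerivAt (fun v ↦ (G v).2)
        (ContinuousLinearMap.snd ℝ _ _ ∘L fderiv ℝ G (φ 0)) (φ 0) :=
      HasFDerivAt.comp (g := Prod.snd) (φ 0) hasFDerivAt_snd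
        (hG.differentiableAt one_ne_zero).hasFDerivAt
    exact HasFDerivAt.comp (g := fun v ↦ (G v).2) (f := Prod.fst) (φ 0, l) h1 hasFDerivAt_fst
  have hp : ∀ s, HasFDerivAt (fun q : HomCoord × HomCoord ↦ dotL q.2 (fderiv ℝ φ (G q.1).2 s)) _
      (φ 0, l) := fun s ↦ by
    have h1 : HasFDerivAt (fun q : HomCoord × HomCoord ↦ fderiv ℝ φ (G q.1).2)
        (fderiv ℝ (fderiv ℝ φ) 0 ∘L (ContinuousLinearMap.snd ℝ _ _ ∘L fderiv ℝ G (φ 0) ∘L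
          ContinuousLinearMap.fst ℝ _ _)) (φ 0, l) :=
      HasFDerivAt.comp (g := fderiv ℝ φ) (φ 0, l) (by rwa [hG0]) ht
    have h2 : HasFDerivAt (fun q : HomCoord × HomCoord ↦ fderiv ℝ φ (G q.1).2 s) _ (φ 0, l) :=
      HasFDerivAt.comp (g := fun L : EuclideanSpace ℝ (Fin k) →L[ℝ] HomCoord ↦ L s) (φ 0, l)
        (ContinuousLinearMap.apply ℝ HomCoord s).hasFDerivAt h1
    exact dotL.hasFDerivAt_of_bilinear hasFDerivAt_snd h2
  have hpre : ∀ s, HasFDerivAt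
      (fun q : HomCoord × HomCoord ↦ (dotL q.2 (fderiv ℝ φ (G q.1).2 s)).re) _ (φ 0, l) := fun s ↦
    HasFDerivAt.comp (g := Complex.re) (φ 0, l) Complex.reCLM.hasFDerivAt (hp s)
  have hpim : ∀ s, HasFDerivAt
      (fun q : HomCoord × HomCoord ↦ (dotL q.2 (fderiv ℝ φ (G q.1).2 s)).im) _ (φ 0, l) := fun s ↦
    HasFDerivAt.comp (g := Complex.im) (φ 0, l) Complex.imCLM.hasFDerivAt (hp s)
  have hf := ((hpre s).mul (hpim s')).sub ((hpre s').mul (hpim s))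
  have hfst : Tendsto (Prod.fst : HomCoord × HomCoord → HomCoord) (𝓝 (φ 0, l)) (𝓝 (φ 0)) :=
    continuousAt_fst
  have htt : Tendsto (fun q : HomCoord × HomCoord ↦ (G q.1).2) (𝓝 (φ 0, l)) (𝓝 0) := by
    have := ht.continuousAt
    rwa [ContinuousAt, hG0] at this
  have h3 := fderiv_eq_zero_of_mem_span_tangentConeAt hf (by simp [hG0, hre]) (by
    filter_upwards [hfst.eventually hGr, htt.eventually (h.eventually_mem_liftSet_iff hr)]
      with p hp hlift hpS
    rw [mem_biconeOver_iff] at hpS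
    have hcone : (G p.1).1 • φ (G p.1).2 = p.1 := hp (mem_coneOver_iff.2 ⟨hpS.1, hpS.2.2.1⟩)
    have hG1 : (G p.1).1 ≠ 0 := by
      intro h0
      rw [h0, zero_smul] at hcone
      exact hpS.1 hcone.symm
    have hφt : φ (G p.1).2 ≠ 0 := by
      intro h0
      rw [h0, smul_zero] at hcone
      exact hpS.1 hcone.symm
    have hpt := (ofVec_eq_ofVec_iff hpS.1 hφt).2 ⟨_, hG1, hcone.symm⟩
    have hmem := hpS.2.2
    rw [hpt] at hmem
    obtain ⟨c, hc0, hcl⟩ := (hlift _ hpS.2.1).1 hmem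
    have hcre : ∀ s, (c * (p.2 ⬝ᵥ fderiv ℝ φ (G p.1).2 s)).re = 0 := fun s ↦ by
      have := (isConormal_iff.1 hcl).2 s
      rwa [smul_dotProduct] at this
    simpa using re_mul_im_sub_eq_zero hc0 (hcre s) (hcre s')) hq
  simp [hG0, hre] at h3
  simp only [Complex.add_re]
  linear_combination h3

end

/-! ### A criterion for general position. -/

section

variable {k : ℕ} {φ : EuclideanSpace ℝ (Fin k) → HomCoord} {N : Set ProjPlane} {z : ProjPlane}

theorem coneTangent_eq_linePlane_of_rep {v : HomCoord} {d : ProjPlane} (hv : v ≠ 0)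
    (h : coneTangent N (ofVec v).rep = linePlane d) : coneTangent N v = linePlane d := by
  obtain ⟨c, hc, hvc⟩ := exists_smul_rep hv
  ext x
  rw [← smul_mem_coneTangent_iff hc, ← hvc, h, ← ofVec_rep d, mem_linePlane_ofVec d.rep_nonzero,
    mem_linePlane_ofVec d.rep_nonzero, smul_dotProduct c, smul_eq_zero, or_iff_right hc]

theorem IsParametrization.mem_liftSet_of_isConormal {r : WithTop ℕ∞}
    (h : IsParametrization r φ N z) (hr : 1 ≤ r) {l : HomCoord} (hl : l ≠ 0)
    (hc : IsConormal (φ 0, fderiv ℝ φ 0) l) : (z, ofVec l) ∈ liftSet N := by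
  rw [← h.ofVec_eq]
  exact ((h.eventually_mem_liftSet_iff hr).self_of_nhds l hl).2 ⟨1, one_ne_zero, by rwa [one_smul]⟩

theorem exists_im_ne_zero_of_injective_borderedMap {E : Type*} [NormedAddCommGroup E]
    [NormedSpace ℝ E] {L : E →L[ℝ] HomCoord} {Q : E →L[ℝ] E →L[ℝ] HomCoord} {l : HomCoord}
    (h : Function.Injective (borderedMap L Q l)) : ∃ s, (l ⬝ᵥ L s).im ≠ 0 := by
  by_contra! h0
  have h1 : borderedMap L Q l (0, 1) = 0 := by
    refine Prod.ext (ContinuousLinearMap.ext fun y ↦ ?_) ?_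
    · simp [borderedMap_fst, h0]
    · simp [borderedMap_snd]
  have h2 := h (h1.trans (map_zero _).symm)
  simpa using congrArg Prod.snd h2

theorem ne_zero_of_injective_borderedMap {E : Type*} [NormedAddCommGroup E]
    [NormedSpace ℝ E] {L : E →L[ℝ] HomCoord} {Q : E →L[ℝ] E →L[ℝ] HomCoord} {l : HomCoord}
    (h : Function.Injective (borderedMap L Q l)) : l ≠ 0 := by
  rintro rfl
  obtain ⟨s, hs⟩ := exists_im_ne_zero_of_injective_borderedMap h
  simp at hs

/-- Injectivity of the bordered map forces `Im (l ⬝ dφ) ≠ 0`, so the tangent space is not a complex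
line. A tangent vector of the lift killed by `dπ` gives a parameter direction `p.2` with `l ⬝ dφ p.2
= 0` and `Re (l ⬝ d²φ (p.2, ·))` proportional to `Im (l ⬝ dφ)`: an element of the kernel of the
bordered map. -/
theorem IsParametrization.isGeneralPosition (h : IsParametrization 2 φ N z) {l : HomCoord}
    (hc : IsConormal (φ 0, fderiv ℝ φ 0) l)
    (hb : Function.Injective (borderedMap (fderiv ℝ φ 0) (fderiv ℝ (fderiv ℝ φ) 0) l)) :
    IsGeneralPosition N z (ofVec l) := by
  have hr : (1 : WithTop ℕ∞) ≤ 2 := one_le_two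
  have hl := ne_zero_of_injective_borderedMap hb
  obtain ⟨s₀, hs₀⟩ := exists_im_ne_zero_of_injective_borderedMap hb
  have hlφ : l ⬝ᵥ φ 0 = 0 := (isConormal_iff.1 hc).1
  have hre : ∀ s, (l ⬝ᵥ fderiv ℝ φ 0 s).re = 0 := (isConormal_iff.1 hc).2
  refine ⟨h.mem_liftSet_of_isConormal hr hl hc, fun e he ↦ ?_, ?_⟩
  · rw [← h.ofVec_eq] at he
    have hT := coneTangent_eq_linePlane_of_rep h.ne_zero he
    rw [(h.eventually_coneTangent hr).self_of_nhds] at hT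
    have hmem : ∀ x, x ∈ linePlane e ↔ x ⬝ᵥ e.rep = 0 := fun x ↦ Iff.rfl
    obtain ⟨c, hce⟩ := exists_eq_smul_of_rePair_eq_zero e.rep_nonzero (l' := l) fun x hx ↦ by
      have h1 : x ∈ (coneMap (φ 0, fderiv ℝ φ 0)).toLinearMap.range := by
        rw [hT]
        exact hx
      obtain ⟨y, rfl⟩ := h1
      exact DFunLike.congr_fun hc y
    have h2 : fderiv ℝ φ 0 s₀ ∈ linePlane e := by
      rw [← hT]
      exact ⟨(0, s₀), by simp⟩
    rw [hmem, dotProduct_comm] at h2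
    exact hs₀ (by rw [hce, smul_dotProduct, h2, smul_zero, Complex.zero_im])
  · rw [← h.ofVec_eq]
    obtain ⟨G, hG, hG0, -, hGr⟩ := h.exists_chart hr
    refine isTransverseToSnd_ofVec h.ne_zero hl fun q hq hq2 ↦ ?_
    obtain ⟨a, ha⟩ := Submodule.mem_span_singleton.1 hq2
    have h1 := h.coneMap_fderiv_eq hr hG hG0 hGr hq
    have h2 := dotProduct_add_eq_zero_of_mem_span_tangentConeAt
      (by rw [dotProduct_comm]; exact hlφ) hq
    have h3 := h.bordered_relation hG hG0 hGr hc hq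
    set p := fderiv ℝ G (φ 0) q.1 with hp
    rw [coneMap_apply] at h1
    have h4 : l ⬝ᵥ fderiv ℝ φ 0 p.2 = 0 := by
      rw [← ha, dotProduct_smul, dotProduct_comm (φ 0), hlφ, smul_zero, zero_add, ← h1,
        dotProduct_comm, dotProduct_add, dotProduct_smul, hlφ, smul_zero, zero_add] at h2
      exact h2
    have hrel : ∀ s, (l ⬝ᵥ fderiv ℝ (fderiv ℝ φ) 0 p.2 s + q.2 ⬝ᵥ fderiv ℝ φ 0 s).re =
        (l ⬝ᵥ fderiv ℝ (fderiv ℝ φ) 0 p.2 s).re - a.im * (l ⬝ᵥ fderiv ℝ φ 0 s).im := fun s ↦ by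
      rw [← ha, smul_dotProduct, smul_eq_mul, Complex.add_re, Complex.mul_re, hre, mul_zero,
        zero_sub, sub_eq_add_neg]
    simp only [hrel] at h3
    -- The second entry is the proportionality factor, read off at `s₀`; the contributions of `a.im`
    -- cancel in the relation.
    have h5 : borderedMap (fderiv ℝ φ 0) (fderiv ℝ (fderiv ℝ φ) 0) l
        (p.2, (l ⬝ᵥ fderiv ℝ (fderiv ℝ φ) 0 p.2 s₀).re / (l ⬝ᵥ fderiv ℝ φ 0 s₀).im) = 0 := by
      refine Prod.ext (ContinuousLinearMap.ext fun s ↦ ?_) ?_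
      · rw [borderedMap_fst]
        have := h3 s s₀
        simp only [Prod.fst_zero, zero_apply]
        field_simp
        linear_combination this
      · rw [borderedMap_snd, h4]
        rfl
    have h6 : p.2 = 0 := congrArg Prod.fst (hb (h5.trans (map_zero _).symm))
    rw [h6, map_zero, add_zero] at h1
    rw [← h1]
    exact Submodule.smul_mem _ _ (Submodule.mem_span_singleton_self _)

theorem IsParametrization.isGeneralPosition_of_point {φ : EuclideanSpace ℝ (Fin 0) → HomCoord}
    (h : IsParametrization 2 φ N z) {d : ProjPlane} (hd : (z, d) ∈ liftSet N) :
    IsGeneralPosition N z d := by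
  have hr : (1 : WithTop ℕ∞) ≤ 2 := one_le_two
  refine ⟨hd, fun e he ↦ ?_, ?_⟩
  · rw [← h.ofVec_eq] at he
    have hT := coneTangent_eq_linePlane_of_rep h.ne_zero he
    rw [(h.eventually_coneTangent hr).self_of_nhds] at hT
    have h1 := finrank_linePlane e
    rw [← hT, LinearMap.finrank_range_of_inj h.coneMap_injective, Module.finrank_prod,
      Complex.finrank_real_complex, finrank_euclideanSpace_fin] at h1
    omega
  · rw [← h.ofVec_eq, ← ofVec_rep d]
    obtain ⟨G, hG, hG0, -, hGr⟩ := h.exists_chart hr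
    refine isTransverseToSnd_ofVec h.ne_zero d.rep_nonzero fun q hq _ ↦ ?_
    have h1 := h.coneMap_fderiv_eq hr hG hG0 hGr hq
    rw [coneMap_apply, Subsingleton.elim (fderiv ℝ G (φ 0) q.1).2 0, map_zero, add_zero] at h1
    rw [← h1]
    exact Submodule.smul_mem _ _ (Submodule.mem_span_singleton_self _)

theorem exists_isConormal_ne_zero {E : Type*} [NormedAddCommGroup E] [NormedSpace ℝ E]
    [FiniteDimensional ℝ E] (hE : Module.finrank ℝ E ≤ 3) (j : HomCoord × (E →L[ℝ] HomCoord)) :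
    ∃ l ≠ 0, IsConormal j l := by
  have h1 := LinearMap.ker_ne_bot_of_finrank_lt (f := (conormalMap j).toLinearMap) (by
    rw [finrank_homCoord, finrank_dual_complex_prod]
    omega)
  obtain ⟨l, hl, hl0⟩ := Submodule.exists_mem_ne_zero_of_ne_bot h1
  exact ⟨l, hl0, hl⟩

end

/-! ### Openness and density of the generic jets. -/

/-- The 2-jets of immersions having a conormal vector at which the bordered second fundamental
form is nondegenerate. -/
def genericJets (k : ℕ) : Set (TwoJet k) :=
  {j | Function.Injective (coneMap (j.1, j.2.1)) ∧
    ∃ l, IsConormal (j.1, j.2.1) l ∧ Function.Injective (borderedMap j.2.1 j.2.2 l)}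

/-- Projecting the fixed vector `l` onto the conormal spaces of nearby jets gives the continuous
extension. -/
theorem exists_continuousAt_conormal {E : Type*} [NormedAddCommGroup E] [NormedSpace ℝ E]
    [FiniteDimensional ℝ E] {p : HomCoord × (E →L[ℝ] HomCoord)}
    (hp : Function.Injective (coneMap p)) {l : HomCoord} (hl : IsConormal p l) :
    ∃ f : HomCoord × (E →L[ℝ] HomCoord) → HomCoord, ContinuousAt f p ∧ f p = l ∧
      ∀ᶠ q in 𝓝 p, IsConormal q (f q) := by
  obtain ⟨S, hS⟩ := exists_conormalMap_rightInverse hp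
  have hA : ContinuousAt (conormalMap (E := E)) p := (ContinuousLinearMap.continuous _).continuousAt
  have hP : ContinuousAt (fun q ↦ kerProj S (conormalMap q)) p :=
    ContinuousAt.comp (g := kerProj S) (contDiffAt_kerProj (r := 0) hS).continuousAt hA
  exact ⟨fun q ↦ kerProj S (conormalMap q) l, hP.clm_apply continuousAt_const, kerProj_eq_self hl,
    (hA.eventually (eventually_isInvertible_comp hS)).mono fun q hq ↦ apply_kerProj hq l⟩

theorem isOpen_genericJets (k : ℕ) : IsOpen (genericJets k) := by
  rw [isOpen_iff_mem_nhds]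
  rintro j ⟨hj, l, hl, hb⟩
  obtain ⟨f, hf, hfj, hfc⟩ := exists_continuousAt_conormal hj hl
  have hpr : Continuous fun i : TwoJet k ↦ (i.1, i.2.1) :=
    continuous_fst.prodMk (continuous_fst.comp continuous_snd)
  have hprj : Tendsto (fun i : TwoJet k ↦ (i.1, i.2.1)) (𝓝 j) (𝓝 (j.1, j.2.1)) := hpr.tendsto j
  have hcone : ∀ᶠ p in 𝓝 (j.1, j.2.1), Function.Injective (coneMap p) :=
    (coneMap (E := EuclideanSpace ℝ (Fin k))).continuous.continuousAt.eventually
      (ContinuousLinearMap.isOpen_injective.mem_nhds hj)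
  have hfp : ContinuousAt (fun i : TwoJet k ↦ f (i.1, i.2.1)) j :=
    ContinuousAt.comp (g := f) hf hpr.continuousAt
  have hB : ContinuousAt (fun i : TwoJet k ↦ borderedMap i.2.1 i.2.2 (f (i.1, i.2.1))) j :=
    ContinuousAt.comp (f := fun i : TwoJet k ↦ (i.2.1, i.2.2, f (i.1, i.2.1)))
      (g := fun i : (EuclideanSpace ℝ (Fin k) →L[ℝ] HomCoord) ×
        (EuclideanSpace ℝ (Fin k) →L[ℝ] EuclideanSpace ℝ (Fin k) →L[ℝ] HomCoord) × HomCoord ↦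
        borderedMap i.1 i.2.1 i.2.2) continuous_borderedMap.continuousAt
      ((continuous_fst.comp continuous_snd).continuousAt.prodMk
        ((continuous_snd.comp continuous_snd).continuousAt.prodMk hfp))
  have hopen := ContinuousLinearMap.isOpen_injective (𝕜 := ℝ)
    (E := EuclideanSpace ℝ (Fin k) × ℝ) (F := (EuclideanSpace ℝ (Fin k) →L[ℝ] ℝ) × ℝ)
  filter_upwards [hprj.eventually hcone, hprj.eventually hfc,
    hB.eventually (hopen.mem_nhds (by rw [mem_ofPred_eq]; beta_reduce; rwa [hfj]))] with i h1 h2 h3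
  exact ⟨h1, _, h2, h3⟩

/-- In a basis with `l ⬝ b 0 = l ⬝ b 1 = 0` and `l ⬝ b 2 = 1`, take `L x = i x₀ b₂ + (x₁ + i x₂)
b₁`, absent coordinates being zero, and `Q = ⟨·, ·⟩ b₂`. A kernel element `(t, μ)` satisfies `⟨t, y⟩
= μ y₀` and `t₀ = 0`, so `⟨t, t⟩ = 0`; then `y = e₀` gives `μ = 0`, which uses `k ≥ 1`. -/
theorem exists_symmetric_genericJet {k : ℕ} (hk : 1 ≤ k) (hk3 : k ≤ 3) {l : HomCoord}
    (hl : l ≠ 0) : ∃ j ∈ symmetricJets k, Function.Injective (coneMap (j.1, j.2.1)) ∧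
      IsConormal (j.1, j.2.1) l ∧ Function.Injective (borderedMap j.2.1 j.2.2 l) := by
  -- With no tangent directions, a conormal of `(l, 0)` is just a vector `v` with `v ⬝ l = 0`.
  obtain ⟨v, hv, hvl⟩ := exists_isConormal_ne_zero (E := EuclideanSpace ℝ (Fin 0)) (by simp) (l, 0)
  obtain ⟨b, hb0, hb1, hb2⟩ : ∃ b : Module.Basis (Fin 3) ℂ HomCoord,
      l ⬝ᵥ b 0 = 0 ∧ l ⬝ᵥ b 1 = 0 ∧ l ⬝ᵥ b 2 = 1 := by
    obtain ⟨b, h0, h1, h2⟩ := exists_adapted_basis hl hv (isConormal_iff.1 hvl).1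
    refine ⟨b, ?_, ?_, ?_⟩
    · rw [h0, dotProduct_comm, (isConormal_iff.1 hvl).1]
    · rw [dotProduct_comm, h1]
    · rw [dotProduct_comm, h2]
  let c : ℕ → EuclideanSpace ℝ (Fin k) →L[ℝ] ℝ := fun i ↦
    if h : i < k then EuclideanSpace.proj ⟨i, h⟩ else 0
  have hc : ∀ x, (∀ i < 3, c i x = 0) → x = 0 := fun x hx ↦ by
    ext ⟨i, hi⟩
    have := hx i (by omega)
    simpa [c, hi] using this
  let L : EuclideanSpace ℝ (Fin k) →L[ℝ] HomCoord :=
    (c 0).smulRight (Complex.I • b 2) + (c 1).smulRight (b 1) + (c 2).smulRight (Complex.I • b 1)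
  have hL : ∀ x, L x = ((c 0 x : ℂ) * Complex.I) • b 2 + (c 1 x + c 2 x * Complex.I : ℂ) • b 1 := by
    intro x
    simp only [L, add_apply, ContinuousLinearMap.smulRight_apply, add_smul, mul_smul,
      Complex.coe_smul, add_assoc]
  have hlL : ∀ x, l ⬝ᵥ L x = c 0 x * Complex.I := fun x ↦ by
    rw [hL, dotProduct_add, dotProduct_smul, dotProduct_smul, hb1, hb2]
    simp
  let Q : EuclideanSpace ℝ (Fin k) →L[ℝ] EuclideanSpace ℝ (Fin k) →L[ℝ] HomCoord :=
    ((ContinuousLinearMap.smulRightL ℝ (EuclideanSpace ℝ (Fin k)) HomCoord).flip (b 2)) ∘L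
      innerSL ℝ
  have hQ : ∀ x y, Q x y = (inner ℝ x y : ℝ) • b 2 := fun x y ↦ rfl
  have hlQ : ∀ x y, l ⬝ᵥ Q x y = (inner ℝ x y : ℝ) := fun x y ↦ by
    rw [hQ, dotProduct_smul, hb2, Complex.real_smul, mul_one]
  refine ⟨(b 0, L, Q), fun s t ↦ ?_, ?_, ?_, ?_⟩
  · change Q s t = Q t s
    rw [hQ, hQ, real_inner_comm]
  · refine coneMap_injective_iff.2 ⟨b.ne_zero 0, fun t ht ↦ hc t ?_⟩
    obtain ⟨a, ha⟩ := Submodule.mem_span_singleton.1 ht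
    change a • b 0 = L t at ha
    rw [hL] at ha
    have h1 := congrArg (fun y ↦ b.repr y 1) ha
    have h2 := congrArg (fun y ↦ b.repr y 2) ha
    simp at h1 h2
    have h3 := congrArg Complex.re h1
    have h4 := congrArg Complex.im h1
    simp at h3 h4
    intro i hi
    interval_cases i
    exacts [h2, h3.symm, h4.symm]
  · refine isConormal_iff.2 ⟨hb0, fun t ↦ ?_⟩
    rw [hlL]
    simp
  · rw [injective_iff_map_eq_zero]
    rintro ⟨t, μ⟩ h
    have h1 : ∀ y, (inner ℝ t y : ℝ) - μ * c 0 y = 0 := fun y ↦ by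
      have := DFunLike.congr_fun (congrArg Prod.fst h) y
      rw [borderedMap_fst] at this
      simpa [hlQ, hlL] using this
    have h2 : c 0 t = 0 := by
      have := congrArg Prod.snd h
      rw [borderedMap_snd] at this
      simpa [hlL] using this
    have ht : t = 0 := by
      have := h1 t
      rw [h2, mul_zero, sub_zero] at this
      exact inner_self_eq_zero.1 this
    have h3 := h1 (EuclideanSpace.single ⟨0, hk⟩ 1)
    have hk0 : 0 < k := hk
    simp [ht, c, hk0] at h3
    rw [ht, h3]
    rfl

theorem tendsto_segment {X : Type*} [NormedAddCommGroup X] [NormedSpace ℝ X] (a b : X) :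
    Tendsto (fun s : ℝ ↦ a + s • (b - a)) (𝓝[≠] 0) (𝓝 a) := by
  have h : Continuous fun s : ℝ ↦ a + s • (b - a) :=
    continuous_const.add (continuous_id.smul continuous_const)
  exact (h.tendsto' 0 a (by simp)).mono_left nhdsWithin_le_nhds

/-- Even a degenerate jet has a nonzero conormal `l`, as `k + 2 < 6`. Moving towards the model jet
with the same `l` preserves symmetry and conormality, which are linear in the jet, and both
injectivity conditions hold for all but finitely many parameters. -/
theorem symmetricJets_subset_closure_genericJets {k : ℕ} (hk : 1 ≤ k) (hk3 : k ≤ 3) :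
    symmetricJets k ⊆ closure (symmetricJets k ∩ genericJets k) := by
  intro j hj
  obtain ⟨l, hl, hc⟩ := exists_isConormal_ne_zero (E := EuclideanSpace ℝ (Fin k))
    (by simpa using hk3) (j.1, j.2.1)
  obtain ⟨i, hi, hi1, hi2, hi3⟩ := exists_symmetric_genericJet hk hk3 hl
  have hF := (finite_not_injective_segment (coneMap (j.1, j.2.1)) _ hi1).union
    (finite_not_injective_segment (borderedMap j.2.1 j.2.2 l) _ hi3)
  let J : ℝ → TwoJet k := fun s ↦
    (j.1 + s • (i.1 - j.1), j.2.1 + s • (i.2.1 - j.2.1), j.2.2 + s • (i.2.2 - j.2.2))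
  have hJ : Tendsto J (𝓝[≠] 0) (𝓝 j) :=
    (tendsto_segment j.1 i.1).prodMk_nhds
      ((tendsto_segment j.2.1 i.2.1).prodMk_nhds (tendsto_segment j.2.2 i.2.2))
  refine mem_closure_of_tendsto hJ ?_
  filter_upwards [eventually_notMem_of_finite hF] with s hs
  simp only [mem_union, mem_ofPred_eq, not_or, not_not] at hs
  have hpair : ((J s).1, (J s).2.1) = (j.1, j.2.1) + s • ((i.1, i.2.1) - (j.1, j.2.1)) := rfl
  refine ⟨fun x y ↦ ?_, ?_, l, ?_, ?_⟩
  · have h1 := hj x y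
    have h2 := hi x y
    change (j.2.2 + s • (i.2.2 - j.2.2)) x y = (j.2.2 + s • (i.2.2 - j.2.2)) y x
    simp [h1, h2]
  · rw [hpair, map_add, map_smul, map_sub]
    exact hs.1
  · rw [isConormal_iff_conormalMap] at hc hi2 ⊢
    rw [hpair, map_add, map_smul, map_sub]
    simp [hc, hi2]
  · change Function.Injective
      (borderedMap (j.2.1 + s • (i.2.1 - j.2.1)) (j.2.2 + s • (i.2.2 - j.2.2)) l)
    rw [borderedMap_segment_left]
    exact hs.2

/-- The conormals at the point form a real vector space, so the segment from any conormal `l₀` to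
the good one stays conormal and is good near `l₀` outside `l₀` itself. -/
theorem IsParametrization.lift_subset_closure_isGeneralPosition {k : ℕ}
    {φ : EuclideanSpace ℝ (Fin k) → HomCoord} {N : Set ProjPlane} {z : ProjPlane}
    (h : IsParametrization 2 φ N z) {l : HomCoord} (hc : IsConormal (φ 0, fderiv ℝ φ 0) l)
    (hb : Function.Injective (borderedMap (fderiv ℝ φ 0) (fderiv ℝ (fderiv ℝ φ) 0) l)) :
    {d | (z, d) ∈ liftSet N} ⊆ closure {d | IsGeneralPosition N z d} := by
  intro d hd
  obtain ⟨l₀, hl₀, rfl, hc₀⟩ := h.exists_isConormal one_le_two hd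
  have hF := finite_not_injective_segment
    (borderedMap (fderiv ℝ φ 0) (fderiv ℝ (fderiv ℝ φ) 0) l₀) _ hb
  have htend : Tendsto (fun s : ℝ ↦ ofVec (l₀ + s • (l - l₀))) (𝓝[≠] 0) (𝓝 (ofVec l₀)) :=
    (tendsto_ofVec hl₀).comp (tendsto_segment l₀ l)
  refine mem_closure_of_tendsto htend ?_
  filter_upwards [eventually_notMem_of_finite hF] with s hs
  simp only [not_not] at hs
  refine h.isGeneralPosition ?_ ?_
  · rw [isConormal_iff_conormalMap] at hc hc₀ ⊢
    rw [map_add, map_smul, map_sub, hc, hc₀, sub_zero, smul_zero, add_zero]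
  · rw [borderedMap_segment_right]
    exact hs

theorem mainTheorem5 (k : ℕ) (hk : k ≤ 3) :
    -- the germs in general position are generic: an open dense set of 2-jets
    (∃ G : Set (TwoJet k), IsOpen G ∧ symmetricJets k ⊆ closure (symmetricJets k ∩ G) ∧
      ∀ (φ : EuclideanSpace ℝ (Fin k) → HomCoord) (N : Set ProjPlane) (z : ProjPlane),
        IsParametrization 2 φ N z → twoJet φ ∈ G →
          {d | (z, d) ∈ liftSet N}.Nonempty ∧
          {d | (z, d) ∈ liftSet N} ⊆ closure {d | IsGeneralPosition N z d}) ∧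
    -- the dual of such a germ is a smooth germ of class `C^1`, and its dual is the initial germ
    (∀ (N : Set ProjPlane) (z d : ProjPlane),
      IsSubmanifoldGerm 2 k N z → IsGeneralPosition N z d →
        ∃ D : Set ProjPlane, IsDualGerm N z d D ∧
          (∃ m ≤ 3, IsSubmanifoldGerm 1 m D d) ∧ IsDualGerm D d z N) := by
  have hr : (1 : WithTop ℕ∞) ≤ 2 := one_le_two
  -- For `k = 0` the border `Im (l ⬝ dφ)` is zero and the bordered map is never injective, but every
  -- line through the point is in general position, so all jets are allowed.
  rcases Nat.eq_zero_or_pos k with rfl | hk1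
  · refine ⟨⟨univ, isOpen_univ, by rw [inter_univ]; exact subset_closure, fun φ N z h _ ↦ ⟨?_, ?_⟩⟩,
      fun N z d ⟨φ, h⟩ hg ↦ ?_⟩
    · obtain ⟨l, hl, hc⟩ := exists_isConormal_ne_zero (by simp) (φ 0, fderiv ℝ φ 0)
      exact ⟨_, h.mem_liftSet_of_isConormal hr hl hc⟩
    · exact fun d hd ↦ subset_closure (h.isGeneralPosition_of_point hd)
    · obtain ⟨D, h1, h2, h3⟩ := exists_dualGerm_of_point h hg.1
      exact ⟨D, h1, ⟨2, by norm_num, h2⟩, h3⟩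
  · refine ⟨⟨genericJets k, isOpen_genericJets k, symmetricJets_subset_closure_genericJets hk1 hk,
      fun φ N z h hj ↦ ?_⟩, fun N z d ⟨φ, h⟩ hg ↦ ?_⟩
    · obtain ⟨-, l, hc, hb⟩ := hj
      exact ⟨⟨_, h.mem_liftSet_of_isConormal hr (ne_zero_of_injective_borderedMap hb) hc⟩,
        h.lift_subset_closure_isGeneralPosition hc hb⟩
    · obtain ⟨D, h1, h2, h3⟩ := exists_dualGerm_of_pos hk1 h hg
      exact ⟨D, h1, ⟨3, le_rfl, h2⟩, h3⟩
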